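/- Let $U\subset\mathbb R^2$ be open, $f:U\to\mathbb R^2$ of class $C^2$, and let $\varphi(t,x)$ denote the value at time $t$ of the solution of $\dot x=f(x)$ in $U$ starting at time $0$ in $x$. Let $x^*\in U$ be a hyperbolic (hence isolated) equilibrium such that $Df(x^*)$ has eigenvalues $\lambda_1>0>\lambda_2$ with corresponding unit eigenvectors $e_1,e_2$. Let $\|\cdot\|$ be the Euclidean norm, $B(x,r)$ the closed ball, $\mu$ the Lebesgue measure. For $T>0$ and a neighbourhood $X_0\subseteq U$ of $x^*$ such that the solutions starting in $X_0$ exist on $[0,T]$, define for $x\in X_0$ with $f(x)\neq0$ the stretching rate along the vector field $$\alpha(x)=\alpha(x,T,f(x)):=\frac1T\log\frac{\|D_x\varphi(T,x)f(x)\|}{\|f(x)\|}$$ and the weighted finite-time metric entropy (FTME) field over the two-point time set $\{0,T\}$ $$H(x):=\limsup_{r\searrow0}\;-\frac1T\log\frac{\mu\big\{y\in X_0:\ \max_{t\in\{0,T\}}\|\varphi(t,y)-\varphi(t,x)\|e^{-\alpha(x)t}\le r\big\}}{\mu(B(x,r))}\in[-\infty,+\infty].$$ For $\rho>0$ let $W^u_\rho$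 (resp. $W^s_\rho$) be the local unstable (resp. stable) manifold of $x^*$, i.e. the set of points $x$ whose solution exists and stays in $B(x^*,\rho)$ for all $t\le0$ (resp. all $t\ge0$) and satisfies $\varphi(t,x)\to x^*$ as $t\to-\infty$ (resp. $t\to+\infty$). With $\angle(v,w)\in[0,\pi]$ the angle between nonzero vectors, define for $\varepsilon,T>0$ the cones $$C^u=\{x\ne x^*:\ \sin\angle(x-x^*,e_2)\ge 2e^{-\frac\varepsilon4T}\},\qquad C^s=\{x\ne x^*:\ \sin\angle(x-x^*,e_2)\le\tfrac\varepsilon4e^{(\lambda_2-\lambda_1)T}\}.$$ **Theorem.** There is a $\rho>0$ such that for every $\varepsilon\in(0,\min\{\lambda_1,-\lambda_2\})$ there is a $T(\varepsilon)>0$ such that for every $T\ge T(\varepsilon)$ and every $X_0$ as above there is a $\delta=\delta(T)>0$ (which may also depend on $X_0$) with $B(x^*,\delta)\subseteq X_0$ and $f\neq0$ on $B(x^*,\delta)\setminus\{x^*\}$, so that $H$ is defined on this punctured ball, and (i) $H(x)\in[0,\lambda_1-\lambda_2+\varepsilon)$ for all $x\in B(x^*,\delta)\setminus\{x^*\}$.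 (ii) $(W^u_\rho\cap B(x^*,\delta))\setminus\{x^*\}\subset C^u$, and $H(x)\in[0,\varepsilon)$ for all $x\in C^u\cap B(x^*,\delta)$. (iii) $(W^s_\rho\cap B(x^*,\delta))\setminus\{x^*\}\subset C^s$, and $H(x)>\lambda_1-\varepsilon$ for all $x\in C^s\cap B(x^*,\delta)$. Moreover $H(x)\in(\lambda_1-\lambda_2-\varepsilon,\lambda_1-\lambda_2+\varepsilon)$ for all $x\in (W^s_\rho\cap B(x^*,\delta))\setminus\{x^*\}$. -/

import Mathlib

open Set Filter Topology MeasureTheory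

noncomputable section

namespace FTME

/-- The Euclidean space `ℝⁿ`, with Euclidean norm and Lebesgue measure. -/
abbrev E (n : ℕ) : Type := EuclideanSpace ℝ (Fin n)

variable {n : ℕ}

/-! ### Weighted orbit metric and finite-time metric entropy

A nonautonomous dynamical system over `J` has the fibres `X t`, `t ∈ J`, and the maps
`φ t s : X s → X t`. -/

/-- Weighted orbit metric `sup_{t ∈ J} ‖φ(t,t₀)y - φ(t,t₀)x‖ e^{-α(t-t₀)}`. -/
def orbitDist (φ : ℝ → ℝ → E n → E n) (J : Set ℝ) (α t₀ : ℝ) (x y : E n) : ℝ :=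
  ⨆ t : J, ‖φ t t₀ y - φ t t₀ x‖ * Real.exp (-α * ((t : ℝ) - t₀))

/-- Closed ball of the weighted orbit metric in the fibre `X t₀`. -/
def orbitBall (X : ℝ → Set (E n)) (φ : ℝ → ℝ → E n → E n) (J : Set ℝ) (α t₀ : ℝ)
    (x₀ : E n) (r : ℝ) : Set (E n) :=
  {x ∈ X t₀ | orbitDist φ J α t₀ x x₀ ≤ r}

/-- Finite-time escape rate
`-(1/|J|) log (μ (orbitBall x₀ r) / μ (closedBall x₀ r))`, with `|J| = max J - min J`;
it is extended-real valued, `-log 0 = +∞`. -/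
def escapeRate (X : ℝ → Set (E n)) (φ : ℝ → ℝ → E n → E n) (J : Set ℝ) (α t₀ : ℝ)
    (x₀ : E n) (r : ℝ) : EReal :=
  -((1 / (sSup J - sInf J) : ℝ) : EReal) *
    ENNReal.log (volume (orbitBall X φ J α t₀ x₀ r) / volume (Metric.closedBall x₀ r))

/-- Finite-time metric entropy with weight `α` at `(t₀, x₀)`: the limsup of the escape rates
as the radius tends to `0` from above. -/
def entropy (X : ℝ → Set (E n)) (φ : ℝ → ℝ → E n → E n) (J : Set ℝ) (α t₀ : ℝ)
    (x₀ : E n) : EReal :=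
  limsup (fun r : ℝ => escapeRate X φ J α t₀ x₀ r) (𝓝[>] (0 : ℝ))

/-! ### The solution map of an autonomous equation `x' = f x` on `U` -/

/-- `γ` stays in `U` and solves `γ' = f ∘ γ` on the interval `I` (one-sided at end points). -/
def IsSolutionOn (f : E n → E n) (U : Set (E n)) (γ : ℝ → E n) (I : Set ℝ) : Prop :=
  ∀ s ∈ I, γ s ∈ U ∧ HasDerivWithinAt γ (f (γ s)) I s

/-- The initial values `x` at time `0` whose solution exists between the times `0` and `t`
(`t` may be negative). -/
def flowDomain (f : E n → E n) (U : Set (E n)) (t : ℝ) : Set (E n) :=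
  {x | ∃ γ : ℝ → E n, γ 0 = x ∧ IsSolutionOn f U γ (uIcc 0 t)}

open Classical in
/-- The value at time `t` of the solution starting at time `0` in `x` (unique for `f` of class
`C¹` on the open set `U`); the value outside `flowDomain f U t` is irrelevant. -/
def flow (f : E n → E n) (U : Set (E n)) (t : ℝ) (x : E n) : E n :=
  if h : ∃ γ : ℝ → E n, γ 0 = x ∧ IsSolutionOn f U γ (uIcc 0 t) then h.choose t else 0

/-- Directional stretching rate `(1/T) log (‖Dφ_T(x) v‖ / ‖v‖)` over the time interval `[0,T]`. -/
def stretchingRate (f : E n → E n) (U : Set (E n)) (x : E n) (T : ℝ) (v : E n) : ℝ :=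
  1 / T * Real.log (‖fderiv ℝ (flow f U T) x v‖ / ‖v‖)

/-- The weighted finite-time metric entropy field `H`: at `x` it is the finite-time metric
entropy at `(0, x)`, over the two-point time set `{0, T}`, of the dynamical system generated
by `x' = f x` with fibres `X s = flow s (X₀)` and `φ(t,s) = flow (t-s)`; the weight is the
stretching rate in the direction `f x`. -/
def weightedField (f : E n → E n) (U : Set (E n)) (T : ℝ) (X₀ : Set (E n)) (x : E n) : EReal :=
  entropy (fun s => flow f U s '' X₀) (fun t s => flow f U (t - s)) {0, T}
    (stretchingRate f U x T (f x)) 0 x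

/-! ### Local stable and unstable manifolds, cones -/

/-- Points whose forward solution exists for all times `t ≥ 0`, stays in `V`
and tends to `xs` as `t → ∞`. -/
def localStable (f : E n → E n) (U : Set (E n)) (xs : E n) (V : Set (E n)) : Set (E n) :=
  {x | (∀ t : ℝ, 0 ≤ t → x ∈ flowDomain f U t ∧ flow f U t x ∈ V) ∧
    Tendsto (fun t : ℝ => flow f U t x) atTop (𝓝 xs)}

/-- Points whose backward solution exists for all times `t ≤ 0`, stays in `V`
and tends to `xs` as `t → -∞`. -/
def localUnstable (f : E n → E n) (U : Set (E n)) (xs : E n) (V : Set (E n)) : Set (E n) :=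
  {x | (∀ t : ℝ, t ≤ 0 → x ∈ flowDomain f U t ∧ flow f U t x ∈ V) ∧
    Tendsto (fun t : ℝ => flow f U t x) atBot (𝓝 xs)}

/-- Unstable cone (apex removed): the angle in `[0, π]` between `x - xs` and `e₂` has sine
at least `2 e^{-εT/4}`. -/
def unstableCone (xs e₂ : E n) (ε T : ℝ) : Set (E n) :=
  {x | x ≠ xs ∧
    2 * Real.exp (-(ε / 4) * T) ≤ Real.sin (InnerProductGeometry.angle (x - xs) e₂)}

/-- Stable cone (apex removed): the angle in `[0, π]` between `x - xs` and `e₂` has sine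
at most `(ε/4) e^{(λ₂-λ₁)T}`. -/
def stableCone (xs e₂ : E n) (l₁ l₂ ε T : ℝ) : Set (E n) :=
  {x | x ≠ xs ∧
    Real.sin (InnerProductGeometry.angle (x - xs) e₂) ≤ ε / 4 * Real.exp ((l₂ - l₁) * T)}

end FTME

end

/-! Write `z = x - xs` and `A = Df(xs)`, with coordinates `p₁ z`, `p₂ z` in the eigenbasis. For
fixed `T` and `x` close to `xs`, `f x` is nearly `A z` and the derivative `D` of the time-`T` map is
nearly `L = exp(TA)`, as closely as desired (`eventually_exists_hasFDerivAt_flow`). Let `s = ‖D (f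
x)‖ / ‖f x‖`. The weight cancels exactly this stretching, so the orbit ball of small radius `r` is
`{‖y - x‖ ≤ r, ‖φ_T y - φ_T x‖ ≤ s r}` (`mem_orbitBall_iff`), and its area decides `H`.

Upper bounds: the orbit ball contains a rectangle with one side of order `r` along `f x` and the
other of order `r s / ‖D‖`, so `H ≤ (1/T) log (4π‖D‖/s)` (`weightedField_le`). Always `‖D‖ ≲
e^{l₁T}` and `s ≳ e^{l₂T}`, which gives `l₁ - l₂`; in the unstable cone `s ≳ e^{(l₁ - ε/4)T}`, which
leaves only `ε`. Lower bound: in the stable cone `s ≲ e^{l₂T}`, so the orbit ball lies in a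
parallelogram with `|p₁| ≲ e^{(l₂-l₁)T} r` and `|p₂| ≲ r` (`le_weightedField`), whence `H > l₁ - l₂
- ε`. Multiplicative constants contribute `O(1/T)` and are absorbed by `ε` for large `T`.

The manifolds lie in the cones because `p₁² - η² p₂²` is nondecreasing along orbits near the saddle
(`monotoneOn_sq_sub_sq`) and tends to `0` on them: take `η = 1` for the unstable manifold and `η`
arbitrarily small for tangency of the stable one. -/

namespace FTME

/-! ### Differentiability of the time-`T` map near an equilibrium -/

section Flow

variable {n : ℕ} {f : E n → E n} {U : Set (E n)} {γ : ℝ → E n} {T : ℝ} {xs : E n}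

lemma exists_solution_of_mem_flowDomain {t : ℝ} {x : E n} (h : x ∈ flowDomain f U t) :
    ∃ γ : ℝ → E n, γ 0 = x ∧ IsSolutionOn f U γ (uIcc 0 t) ∧ flow f U t x = γ t :=
  by
  have h' : ∃ γ : ℝ → E n, γ 0 = x ∧ IsSolutionOn f U γ (uIcc 0 t) := h
  exact ⟨_, h'.choose_spec.1, h'.choose_spec.2, by rw [flow, dif_pos h']⟩

lemma flow_zero {x : E n} (hx : x ∈ U) : flow f U 0 x = x := by
  have h : x ∈ flowDomain f U 0 := by
    refine ⟨fun _ => x, rfl, fun s hs => ⟨hx, ?_⟩⟩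
    rw [uIcc_self] at hs ⊢
    -- On the one-point interval the derivative condition is void, so a constant curve is a
    -- solution.
    exact HasFDerivWithinAt.of_subsingleton subsingleton_singleton
  obtain ⟨γ, h0, -, h1⟩ := exists_solution_of_mem_flowDomain h
  rw [h1, h0]

lemma mem_of_mem_flowDomain {t : ℝ} {x : E n} (h : x ∈ flowDomain f U t) : x ∈ U := by
  obtain ⟨γ, h0, hγ, -⟩ := exists_solution_of_mem_flowDomain h
  exact h0 ▸ (hγ 0 left_mem_uIcc).1

lemma IsSolutionOn.mono {I J : Set ℝ} (h : IsSolutionOn f U γ I) (hJ : J ⊆ I) :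
    IsSolutionOn f U γ J :=
  fun s hs => ⟨(h s (hJ hs)).1, (h s (hJ hs)).2.mono hJ⟩

lemma IsSolutionOn.continuousOn {I : Set ℝ} (h : IsSolutionOn f U γ I) : ContinuousOn γ I :=
  fun s hs => (h s hs).2.continuousWithinAt

lemma IsSolutionOn.hasDerivWithinAt_Ici {a b : ℝ} (h : IsSolutionOn f U γ (Icc a b)) :
    ∀ t ∈ Ico a b, HasDerivWithinAt γ (f (γ t)) (Ici t) t :=
  fun t ht => (h t ⟨ht.1, ht.2.le⟩).2.mono_of_mem_nhdsWithin (Icc_mem_nhdsGE_of_mem ht)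

lemma IsSolutionOn.hasDerivWithinAt_Iic {a b : ℝ} (h : IsSolutionOn f U γ (Icc a b)) :
    ∀ t ∈ Ioc a b, HasDerivWithinAt γ (f (γ t)) (Iic t) t :=
  fun t ht => (h t ⟨ht.1.le, ht.2⟩).2.mono_of_mem_nhdsWithin (Icc_mem_nhdsLE_of_mem ht)

/-- Near a point where `f` is of class `C²` its derivative is bounded and Lipschitz. -/
lemma exists_closedBall_fderiv_bounds (hf : ContDiffAt ℝ 2 f xs) :
    ∃ r > 0, ∃ K > 0, ∃ C > 0,
      (∀ x ∈ Metric.closedBall xs r, DifferentiableAt ℝ f x ∧ ‖fderiv ℝ f x‖ ≤ K) ∧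
      ∀ x ∈ Metric.closedBall xs r, ∀ y ∈ Metric.closedBall xs r,
        ‖fderiv ℝ f x - fderiv ℝ f y‖ ≤ C * ‖x - y‖ := by
  have h1 : ContDiffAt ℝ 1 (fderiv ℝ f) xs := hf.fderiv_right (by norm_num)
  obtain ⟨C, t, ht, hC⟩ := h1.exists_lipschitzOnWith
  have h2 : ∀ᶠ x in 𝓝 xs, ‖fderiv ℝ f x‖ < ‖fderiv ℝ f xs‖ + 1 :=
    h1.continuousAt.norm.eventually_lt continuousAt_const (by simp)
  have h3 : ∀ᶠ x in 𝓝 xs, DifferentiableAt ℝ f x := by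
    filter_upwards [hf.eventually (by simp)] with x hx using hx.differentiableAt (by simp)
  obtain ⟨r, hr, hr'⟩ := Metric.nhds_basis_closedBall.eventually_iff.1
    ((eventually_mem_set.2 ht).and (h2.and h3))
  refine ⟨r, hr, ‖fderiv ℝ f xs‖ + 1, by positivity, C + 1, by positivity,
    fun x hx => ⟨(hr' hx).2.2, (hr' hx).2.1.le⟩, fun x hx y hy => ?_⟩
  have := hC.dist_le_mul x (hr' hx).1 y (hr' hy).1
  rw [dist_eq_norm, dist_eq_norm] at this
  nlinarith [norm_nonneg (x - y)]

/-- Solutions that start near an equilibrium stay near it. -/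
lemma IsSolutionOn.norm_sub_le (hγ : IsSolutionOn f U γ (Icc 0 T)) {r K δ : ℝ} (hK : 0 ≤ K)
    (hf : ∀ x ∈ Metric.closedBall xs r, ‖f x‖ ≤ K * ‖x - xs‖) (hδ : 0 < δ)
    (hr : δ * Real.exp ((K + 1) * T) ≤ r) (h0 : ‖γ 0 - xs‖ ≤ δ) :
    ∀ t ∈ Icc 0 T, ‖γ t - xs‖ ≤ δ * Real.exp ((K + 1) * T) := by
  have hexp : ∀ t ∈ Icc 0 T, δ * Real.exp ((K + 1) * t) ≤ δ * Real.exp ((K + 1) * T) := by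
    intro t ht
    have := ht.2
    gcongr
  intro t ht
  refine le_trans ?_ (hexp t ht)
  -- The barrier grows at rate `K + 1` rather than `K`, so that the required inequality at a contact
  -- point is strict.
  refine image_norm_le_of_norm_deriv_right_lt_deriv_boundary
    (f := fun t => γ t - xs) (f' := fun t => f (γ t))
    (B := fun t => δ * Real.exp ((K + 1) * t))
    (B' := fun t => δ * (Real.exp ((K + 1) * t) * (K + 1)))
    (hγ.continuousOn.sub continuousOn_const)
    (fun t ht => (hγ.hasDerivWithinAt_Ici t ht).sub_const xs) (by simpa using h0)
    (fun t => ?_) ?_ ht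
  · have := ((hasDerivAt_id t).const_mul (K + 1)).exp.const_mul δ
    simpa using this
  · intro s hs hs'
    have h1 := hexp s ⟨hs.1, hs.2.le⟩
    have h2 := hf (γ s) (by rw [mem_closedBall_iff_norm, hs']; exact h1.trans hr)
    rw [hs'] at h2
    have : 0 < δ * Real.exp ((K + 1) * s) := by positivity
    nlinarith

/-- A linear equation with small continuous coefficients has a solution operator close to `1`. -/
lemma exists_fundamental_solution {B : ℝ → E n →L[ℝ] E n} (hT : 0 ≤ T)
    (hB : ContinuousOn B (Icc 0 T)) {κ : ℝ} (hκ : 0 < κ) (hκT : 2 * κ * T ≤ 1)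
    (hBκ : ∀ t ∈ Icc 0 T, ‖B t‖ ≤ κ) :
    ∃ W : ℝ → E n →L[ℝ] E n, W 0 = 1 ∧
      (∀ t ∈ Icc 0 T, HasDerivWithinAt W (B t * W t) (Icc 0 T) t) ∧
      ‖W T - 1‖ ≤ Real.exp (κ * T) - 1 := by
  have hone : ‖(1 : E n →L[ℝ] E n)‖ ≤ 1 := ContinuousLinearMap.norm_id_le
  -- On the unit ball around `1` one has `‖W‖ ≤ 2`, so the speed is at most `2κ`; since `2κT ≤ 1`,
  -- one Picard–Lindelöf step covers all of `[0, T]`.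
  have hPL : IsPicardLindelof (fun t W => B t * W) (⟨0, left_mem_Icc.2 hT⟩ : Icc 0 T) 1 1 0
      (2 * .mk κ hκ.le) (.mk κ hκ.le) := by
    refine ⟨fun t ht => ?_, fun W _ => hB.mul continuousOn_const, fun t ht W hW => ?_, ?_⟩
    · refine LipschitzOnWith.of_dist_le_mul fun V _ W _ => ?_
      rw [dist_eq_norm, dist_eq_norm, ← mul_sub]
      exact (norm_mul_le _ _).trans (mul_le_mul_of_nonneg_right (hBκ t ht) (norm_nonneg _))
    · have h1 : ‖W‖ ≤ 2 := by
        have h2 := norm_add_le (W - 1) 1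
        rw [mem_closedBall_iff_norm] at hW
        simp only [sub_add_cancel] at h2
        push_cast at hW
        linarith
      refine (norm_mul_le _ _).trans ?_
      have := mul_le_mul (hBκ t ht) h1 (norm_nonneg _) hκ.le
      change _ ≤ 2 * κ
      linarith
    · simp only [sub_zero, sub_self, max_eq_left hT]
      change 2 * κ * T ≤ 1 - 0
      linarith
  obtain ⟨W, hW0, hW⟩ := hPL.exists_eq_forall_mem_Icc_hasDerivWithinAt₀
  refine ⟨W, hW0, hW, ?_⟩
  have := norm_le_gronwallBound_of_norm_deriv_right_le (f := fun t => W t - 1)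
    (f' := fun t => B t * W t) (δ := 0) (K := κ) (ε := κ) (a := 0) (b := T)
    (ContinuousOn.sub (fun t ht => (hW t ht).continuousWithinAt) continuousOn_const)
    (fun t ht => ((hW t ⟨ht.1, ht.2.le⟩).mono_of_mem_nhdsWithin
      (Icc_mem_nhdsGE_of_mem ht)).sub_const 1) (by simp at hW0; simp [hW0])
    (fun t ht => ?_) T (right_mem_Icc.2 hT)
  · rw [gronwallBound_of_K_ne_0 hκ.ne'] at this
    simpa [hκ.ne'] using this
  · have h1 : B t * W t = B t * (W t - 1) + B t * 1 := by rw [← mul_add]; simp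
    have h2 := hBκ t ⟨ht.1, ht.2.le⟩
    rw [h1]
    refine (norm_add_le _ _).trans (add_le_add ((norm_mul_le _ _).trans ?_) ?_)
    · gcongr
    · simpa using h2

/-- The first order Taylor estimate on a ball where the derivative is Lipschitz. -/
lemma norm_image_sub_sub_fderiv_le {r C : ℝ}
    (hd : ∀ x ∈ Metric.closedBall xs r, DifferentiableAt ℝ f x)
    (hC : ∀ x ∈ Metric.closedBall xs r, ∀ y ∈ Metric.closedBall xs r,
        ‖fderiv ℝ f x - fderiv ℝ f y‖ ≤ C * ‖x - y‖) (hC0 : 0 ≤ C) {x y : E n}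
    (hx : x ∈ Metric.closedBall xs r) (hy : y ∈ Metric.closedBall xs r) :
    ‖f y - f x - fderiv ℝ f x (y - x)‖ ≤ C * ‖y - x‖ * ‖y - x‖ := by
  have hseg : segment ℝ x y ⊆ Metric.closedBall xs r :=
    (convex_closedBall xs r).segment_subset hx hy
  refine Convex.norm_image_sub_le_of_norm_fderiv_le' (s := segment ℝ x y)
    (fun z hz => hd z (hseg hz)) (fun z hz => ?_) (convex_segment x y)
    (left_mem_segment ℝ x y) (right_mem_segment ℝ x y)
  refine (hC z (hseg hz) x hx).trans ?_
  gcongr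
  obtain ⟨θ, hθ, rfl⟩ := (segment_eq_image' ℝ x y ▸ hz :)
  simp only [add_sub_cancel_left, norm_smul, Real.norm_eq_abs, abs_of_nonneg hθ.1]
  exact mul_le_of_le_one_left (norm_nonneg _) hθ.2

/-- The time-`T` map is differentiable at `x` if the solution of the variational equation is its
derivative. -/
lemma hasFDerivAt_flow {r K C : ℝ} (hT : 0 ≤ T) (hK : 0 < K) (hC0 : 0 ≤ C)
    (hd : ∀ x ∈ Metric.closedBall xs r, DifferentiableAt ℝ f x ∧ ‖fderiv ℝ f x‖ ≤ K)
    (hC : ∀ x ∈ Metric.closedBall xs r, ∀ y ∈ Metric.closedBall xs r,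
        ‖fderiv ℝ f x - fderiv ℝ f y‖ ≤ C * ‖x - y‖) {x : E n} {N : Set (E n)} (hN : N ∈ 𝓝 x)
    {γ : E n → ℝ → E n} (hγ : ∀ y ∈ N, γ y 0 = y ∧ IsSolutionOn f U (γ y) (Icc 0 T) ∧
      flow f U T y = γ y T ∧ ∀ t ∈ Icc 0 T, γ y t ∈ Metric.closedBall xs r)
    {V : ℝ → E n →L[ℝ] E n} (hV0 : V 0 = 1)
    (hV : ∀ t ∈ Icc 0 T, HasDerivWithinAt V (fderiv ℝ f (γ x t) * V t) (Icc 0 T) t) :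
    HasFDerivAt (flow f U T) (V T) x := by
  have hx := hγ x (mem_of_mem_nhds hN)
  have hlip : LipschitzOnWith (.mk K hK.le) f (Metric.closedBall xs r) :=
    (convex_closedBall xs r).lipschitzOnWith_of_nnnorm_fderiv_le
      (fun z hz => (hd z hz).1) (fun z hz => (hd z hz).2)
  set G := Real.exp (K * T) with hG
  -- Grönwall for the remainder `γ y - γ x - V (y - x)`: it starts at `0` and its forcing term is
  -- quadratic in `‖y - x‖`.
  have key : ∀ y ∈ N, ‖flow f U T y - flow f U T x - V T (y - x)‖ ≤
      (C * G * G / K * (G - 1)) * ‖‖y - x‖ ^ 2‖ := by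
    intro y hyN
    have hy := hγ y hyN
    have hdist : ∀ t ∈ Icc 0 T, ‖γ y t - γ x t‖ ≤ ‖y - x‖ * G := by
      intro t ht
      have := dist_le_of_trajectories_ODE_of_mem (v := fun _ => f) (s := fun _ =>
        Metric.closedBall xs r) (δ := ‖y - x‖) (fun _ _ => hlip) hy.2.1.continuousOn
        hy.2.1.hasDerivWithinAt_Ici
        (fun t ht => hy.2.2.2 t ⟨ht.1, ht.2.le⟩) hx.2.1.continuousOn hx.2.1.hasDerivWithinAt_Ici
        (fun t ht => hx.2.2.2 t ⟨ht.1, ht.2.le⟩) (by rw [hy.1, hx.1, dist_eq_norm]) t ht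
      rw [dist_eq_norm] at this
      refine this.trans ?_
      have h2 := ht.2
      rw [sub_zero, NNReal.coe_mk, hG]
      gcongr
    have hgr := norm_le_gronwallBound_of_norm_deriv_right_le
      (f := fun t => γ y t - γ x t - V t (y - x))
      (f' := fun t => f (γ y t) - f (γ x t) - (fderiv ℝ f (γ x t) * V t) (y - x))
      (δ := 0) (K := K) (ε := C * (‖y - x‖ * G) * (‖y - x‖ * G)) (a := 0) (b := T)
      ((hy.2.1.continuousOn.sub hx.2.1.continuousOn).sub
        (ContinuousOn.clm_apply (fun t ht => (hV t ht).continuousWithinAt) continuousOn_const))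
      (fun t ht => ((hy.2.1.hasDerivWithinAt_Ici t ht).sub
        (hx.2.1.hasDerivWithinAt_Ici t ht)).sub ?_) ?_ ?_ T (right_mem_Icc.2 hT)
    · rw [gronwallBound_of_K_ne_0 hK.ne'] at hgr
      rw [hy.2.2.1, hx.2.2.1]
      refine hgr.trans (le_of_eq ?_)
      simp only [sub_zero, zero_mul, zero_add, norm_pow, norm_norm, ← hG]
      ring
    · have := ((hV t ⟨ht.1, ht.2.le⟩).mono_of_mem_nhdsWithin
        (Icc_mem_nhdsGE_of_mem ht)).clm_apply (hasDerivWithinAt_const t (Ici t) (y - x))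
      simpa using this
    · simp [hy.1, hx.1, hV0]
    · intro t ht
      have ht' : t ∈ Icc 0 T := ⟨ht.1, ht.2.le⟩
      have h1 := norm_image_sub_sub_fderiv_le (fun z hz => (hd z hz).1) hC hC0
        (hx.2.2.2 t ht') (hy.2.2.2 t ht')
      have h2 : f (γ y t) - f (γ x t) - (fderiv ℝ f (γ x t) * V t) (y - x) =
          fderiv ℝ f (γ x t) (γ y t - γ x t - V t (y - x)) +
          (f (γ y t) - f (γ x t) - fderiv ℝ f (γ x t) (γ y t - γ x t)) := by
        simp only [map_sub, mul_apply_eq_comp]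
        abel
      rw [h2]
      refine (norm_add_le _ _).trans (add_le_add ?_ (h1.trans ?_))
      · exact (ContinuousLinearMap.le_opNorm _ _).trans
          (mul_le_mul_of_nonneg_right (hd _ (hx.2.2.2 t ht')).2 (norm_nonneg _))
      · have := hdist t ht'
        gcongr
  rw [hasFDerivAt_iff_isLittleO]
  exact (Asymptotics.IsBigO.of_bound _ (mem_of_superset hN key)).trans_isLittleO
    (Asymptotics.isLittleO_pow_sub_sub x one_lt_two)

/-- Continuous differentiability of the time-`T` map at an equilibrium, in terms of the fundamental
solution `Φ` of the linearization and its inverse `Ψ`. -/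
theorem eventually_exists_hasFDerivAt_flow (hf : ContDiffAt ℝ 2 f xs) (heq : f xs = 0)
    (hT : 0 ≤ T)
    {Φ Ψ : ℝ → E n →L[ℝ] E n} (hΦ0 : Φ 0 = 1)
    (hΦ : ∀ t, HasDerivAt Φ (fderiv ℝ f xs * Φ t) t) (hΨ : Continuous Ψ)
    (hΦΨ : ∀ t, Φ t * Ψ t = 1) {X₀ : Set (E n)} (hX₀ : X₀ ⊆ flowDomain f U T)
    (hX₀' : X₀ ∈ 𝓝 xs) {η : ℝ} (hη : 0 < η) :
    ∀ᶠ x in 𝓝 xs, ∃ D, HasFDerivAt (flow f U T) D x ∧ ‖D - Φ T‖ ≤ η := by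
  obtain ⟨r, hr, K, hK, C, hC0, hd, hC⟩ := exists_closedBall_fderiv_bounds hf
  have hΦc : Continuous Φ := continuous_iff_continuousAt.2 fun t => (hΦ t).continuousAt
  obtain ⟨M₁, hM₁⟩ := isCompact_Icc.exists_bound_of_continuousOn (s := Icc 0 T) hΦc.continuousOn
  obtain ⟨M₂, hM₂⟩ := isCompact_Icc.exists_bound_of_continuousOn (s := Icc 0 T) hΨ.continuousOn
  have hT0 : (0 : ℝ) ∈ Icc 0 T := left_mem_Icc.2 hT
  have hM₁0 : 0 ≤ M₁ := (norm_nonneg _).trans (hM₁ 0 hT0)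
  have hM₂0 : 0 ≤ M₂ := (norm_nonneg _).trans (hM₂ 0 hT0)
  -- `κ` will bound the coefficients of the equation for `W` below; `s` is a radius of closeness to
  -- `xs` that guarantees this bound.
  obtain ⟨κ, hκ, hκT, hκη⟩ : ∃ κ > 0, 2 * κ * T ≤ 1 ∧ M₁ * (Real.exp (κ * T) - 1) ≤ η := by
    have h1 : ∀ᶠ κ in 𝓝[>] (0 : ℝ), 2 * κ * T < 1 :=
      (Continuous.tendsto' (by fun_prop) 0 0 (by simp) |>.mono_left
        nhdsWithin_le_nhds).eventually_lt_const (by norm_num)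
    have h2 : ∀ᶠ κ in 𝓝[>] (0 : ℝ), M₁ * (Real.exp (κ * T) - 1) < η :=
      (Continuous.tendsto' (by fun_prop) 0 0 (by simp) |>.mono_left
        nhdsWithin_le_nhds).eventually_lt_const hη
    obtain ⟨κ, hκ⟩ := (Eventually.and (self_mem_nhdsWithin (s := Ioi 0)) (h1.and h2)).exists
    exact ⟨κ, hκ.1, hκ.2.1.le, hκ.2.2.le⟩
  obtain ⟨s, hs, hsr, hsκ⟩ : ∃ s > 0, s ≤ r ∧ M₂ * (C * s * M₁) ≤ κ := by
    have h2 : ∀ᶠ s in 𝓝[>] (0 : ℝ), M₂ * (C * s * M₁) < κ :=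
      (Continuous.tendsto' (by fun_prop) 0 0 (by simp) |>.mono_left
        nhdsWithin_le_nhds).eventually_lt_const hκ
    obtain ⟨s, hs⟩ := (Eventually.and (self_mem_nhdsWithin (s := Ioi 0)) (h2.and
      (mem_nhdsWithin_of_mem_nhds (Iic_mem_nhds hr)))).exists
    exact ⟨s, hs.1, hs.2.2, hs.2.1.le⟩
  have hsub : Metric.closedBall xs s ⊆ Metric.closedBall xs r :=
    Metric.closedBall_subset_closedBall hsr
  have hxs : xs ∈ Metric.closedBall xs s := Metric.mem_closedBall_self hs.le
  have hfK : ∀ x ∈ Metric.closedBall xs s, ‖f x‖ ≤ K * ‖x - xs‖ := by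
    intro x hx
    simpa [heq] using (convex_closedBall xs s).norm_image_sub_le_of_norm_fderiv_le
      (fun z hz => (hd z (hsub hz)).1) (fun z hz => (hd z (hsub hz)).2) hxs hx
  -- Orbits starting within `δ` of `xs` remain within `s` up to time `T`.
  set δ := s * Real.exp (-((K + 1) * T)) with hδ
  have hδ0 : 0 < δ := by positivity
  have hδs : δ * Real.exp ((K + 1) * T) = s := by
    rw [hδ, mul_assoc, ← Real.exp_add]; simp
  set N := X₀ ∩ Metric.closedBall xs δ with hN
  have hNxs : N ∈ 𝓝 xs := inter_mem hX₀' (Metric.closedBall_mem_nhds xs hδ0)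
  have hsol : ∀ y : E n, ∃ γ : ℝ → E n, y ∈ N → γ 0 = y ∧ IsSolutionOn f U γ (Icc 0 T) ∧
      flow f U T y = γ T ∧ ∀ t ∈ Icc 0 T, γ t ∈ Metric.closedBall xs s := by
    intro y
    by_cases hy : y ∈ N
    · obtain ⟨γ, h0, hγ, h1⟩ := exists_solution_of_mem_flowDomain (hX₀ hy.1)
      rw [uIcc_of_le hT] at hγ
      refine ⟨γ, fun _ => ⟨h0, hγ, h1, fun t ht => ?_⟩⟩
      rw [mem_closedBall_iff_norm, ← hδs]
      refine hγ.norm_sub_le hK.le hfK hδ0 hδs.le ?_ t ht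
      rw [h0]
      exact mem_closedBall_iff_norm.1 hy.2
    · exact ⟨fun _ => 0, fun h => absurd h hy⟩
  choose γ hγ using hsol
  filter_upwards [eventually_mem_nhds_iff.2 hNxs] with x hx
  have hxγ := hγ x (mem_of_mem_nhds hx)
  have hΨΦ : ∀ t, Ψ t * Φ t = 1 := fun t => by
    have h : (Φ t : E n →ₗ[ℝ] E n) * (Ψ t : E n →ₗ[ℝ] E n) = 1 := by
      ext1 z
      exact congrArg (fun L : E n →L[ℝ] E n => L z) (hΦΨ t)
    ext1 z
    exact congrArg (fun L : E n →ₗ[ℝ] E n => L z) (mul_eq_one_comm.1 h)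
  have hDc : ContinuousOn (fun t => fderiv ℝ f (γ x t)) (Icc 0 T) := by
    have : ContinuousOn (fderiv ℝ f) (Metric.closedBall xs r) :=
      (LipschitzOnWith.of_dist_le_mul (K := .mk C hC0.le) fun a ha b hb => by
        rw [dist_eq_norm, dist_eq_norm]; exact hC a ha b hb).continuousOn
    exact this.comp hxγ.2.1.continuousOn fun t ht => hsub (hxγ.2.2.2 t ht)
  -- Variation of constants: the variational equation along `γ x` is solved by `Φ W`, where `W' = Ψ
  -- (Df(γ x) - Df(xs)) Φ W` has small coefficients, so `W T` is close to `1`.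
  obtain ⟨W, hW0, hW, hW1⟩ := exists_fundamental_solution
    (B := fun t => Ψ t * ((fderiv ℝ f (γ x t) - fderiv ℝ f xs) * Φ t)) hT
    (hΨ.continuousOn.mul ((hDc.sub continuousOn_const).mul hΦc.continuousOn)) hκ hκT
    (fun t ht => by
      have h1 := hC _ (hsub (hxγ.2.2.2 t ht)) xs (hsub hxs)
      have h2 := mem_closedBall_iff_norm.1 (hxγ.2.2.2 t ht)
      refine le_trans ?_ hsκ
      refine (norm_mul_le _ _).trans (mul_le_mul (hM₂ t ht) ((norm_mul_le _ _).trans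
        (mul_le_mul (h1.trans ?_) (hM₁ t ht) (norm_nonneg _) (by positivity))) (norm_nonneg _)
        hM₂0)
      gcongr)
  refine ⟨Φ T * W T, hasFDerivAt_flow hT hK hC0.le (fun z hz => hd z (hsub hz))
    (fun a ha b hb => hC a (hsub ha) b (hsub hb)) hx hγ (V := fun t => Φ t * W t)
    (by simp [hΦ0, hW0]) (fun t ht => ?_), ?_⟩
  · refine ((hΦ t).hasDerivWithinAt.mul (hW t ht)).congr_deriv ?_
    have : Φ t * (Ψ t * ((fderiv ℝ f (γ x t) - fderiv ℝ f xs) * Φ t) * W t) =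
        (Φ t * Ψ t) * ((fderiv ℝ f (γ x t) - fderiv ℝ f xs) * Φ t * W t) := by
      simp only [mul_assoc]
    rw [this, hΦΨ, one_mul, sub_mul, sub_mul]
    simp only [mul_assoc]
    abel
  · have : Φ T * W T - Φ T = Φ T * (W T - 1) := by rw [mul_sub, mul_one]
    rw [this]
    refine (norm_mul_le _ _).trans (le_trans ?_ hκη)
    have := hM₁ T (right_mem_Icc.2 hT)
    gcongr

end Flow

/-! ### Area of a parallelogram -/

section Volume

lemma volume_coordinate_box (A B : ℝ) (hA : 0 ≤ A) :
    volume {c : E 2 | |c 0| ≤ A ∧ |c 1| ≤ B} = ENNReal.ofReal (4 * A * B) := by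
  have h : {c : E 2 | |c 0| ≤ A ∧ |c 1| ≤ B} =
      (WithLp.ofLp : E 2 → Fin 2 → ℝ) ⁻¹' (Icc ![-A, -B] ![A, B]) := by
    ext c
    simp [Pi.le_def, Fin.forall_fin_two, abs_le]
    tauto
  rw [h, (PiLp.volume_preserving_ofLp (Fin 2)).measure_preimage
    measurableSet_Icc.nullMeasurableSet, Real.volume_Icc_pi]
  simp only [Fin.prod_univ_two, Matrix.cons_val_zero, Matrix.cons_val_one]
  rw [← ENNReal.ofReal_mul (by linarith)]
  ring_nf

lemma volume_parallelogram (v w : E 2) (A B : ℝ) (hA : 0 ≤ A) :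
    volume {z : E 2 | ∃ a b : ℝ, |a| ≤ A ∧ |b| ≤ B ∧ z = a • v + b • w} =
      ENNReal.ofReal (|v 0 * w 1 - v 1 * w 0| * (4 * A * B)) := by
  set β := (EuclideanSpace.basisFun (Fin 2) ℝ).toBasis
  set M : Matrix (Fin 2) (Fin 2) ℝ := !![v 0, w 0; v 1, w 1]
  have hdet : LinearMap.det (Matrix.toLin β β M) = v 0 * w 1 - v 1 * w 0 := by
    rw [LinearMap.det_toLin, Matrix.det_fin_two_of]; ring
  have happ : ∀ c : E 2, Matrix.toLin β β M c = c 0 • v + c 1 • w := by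
    intro c
    rw [← Matrix.toEuclideanLin_eq_toLin_orthonormal]
    ext i
    fin_cases i <;> simp [Matrix.toLpLin_apply, M, dotProduct] <;> ring
  have himg : {z : E 2 | ∃ a b : ℝ, |a| ≤ A ∧ |b| ≤ B ∧ z = a • v + b • w} =
      Matrix.toLin β β M '' {c : E 2 | |c 0| ≤ A ∧ |c 1| ≤ B} := by
    ext z
    constructor
    · rintro ⟨a, b, ha, hb, rfl⟩
      exact ⟨!₂[a, b], by simpa using ⟨ha, hb⟩, by rw [happ]; simp⟩
    · rintro ⟨c, hc, rfl⟩
      exact ⟨c 0, c 1, hc.1, hc.2, happ c⟩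
  rw [himg, Measure.addHaar_image_linearMap, hdet, volume_coordinate_box A B hA,
    ENNReal.ofReal_mul (abs_nonneg _)]

end Volume

/-! ### From areas of orbit balls to entropy -/

section Entropy

variable {X : ℝ → Set (E 2)} {φ : ℝ → ℝ → E 2 → E 2} {T α t₀ : ℝ} {x : E 2}

lemma sSup_sub_sInf_pair (hT : 0 ≤ T) : sSup ({0, T} : Set ℝ) - sInf {0, T} = T := by
  rw [csSup_pair, csInf_pair]
  simp [hT]

lemma ofReal_div_volume_closedBall {c r : ℝ} (hr : 0 < r) (x : E 2) :
    ENNReal.ofReal (c * r ^ 2) / volume (Metric.closedBall x r) =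
      ENNReal.ofReal (c / Real.pi) := by
  rw [EuclideanSpace.volume_closedBall_fin_two, ← ENNReal.ofReal_pow hr.le,
    ← ENNReal.ofReal_mul (by positivity), ← ENNReal.ofReal_div_of_pos (by positivity)]
  congr 1
  field_simp

/-- The Euclidean disc has area `π r²`, so a quadratic area bound `c r²` gives a bound independent
of `r`, which survives the limsup. -/
lemma escapeRate_le {c r : ℝ} (hT : 0 < T) (hr : 0 < r) (hc : 0 < c)
    (h : ENNReal.ofReal (c * r ^ 2) ≤ volume (orbitBall X φ {0, T} α t₀ x r)) :
    escapeRate X φ {0, T} α t₀ x r ≤ ((1 / T * Real.log (Real.pi / c) : ℝ) : EReal) := by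
  have h1 : ((Real.log (c / Real.pi) : ℝ) : EReal) ≤
      ENNReal.log (volume (orbitBall X φ {0, T} α t₀ x r) / volume (Metric.closedBall x r)) := by
    rw [← ENNReal.log_ofReal_of_pos (by positivity), ← ofReal_div_volume_closedBall hr x]
    gcongr
  rw [escapeRate, sSup_sub_sInf_pair hT.le, EReal.neg_mul]
  have h2 : ((1 / T * Real.log (Real.pi / c) : ℝ) : EReal) =
      -(((1 / T : ℝ) : EReal) * ((Real.log (c / Real.pi) : ℝ) : EReal)) := by
    rw [← inv_div c Real.pi, Real.log_inv]
    norm_cast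
    ring
  rw [h2, EReal.neg_le_neg_iff]
  exact mul_le_mul_of_nonneg_left h1 (by exact_mod_cast (by positivity : (0 : ℝ) ≤ 1 / T))

lemma le_escapeRate {c r : ℝ} (hT : 0 < T) (hr : 0 < r) (hc : 0 < c)
    (h : volume (orbitBall X φ {0, T} α t₀ x r) ≤ ENNReal.ofReal (c * r ^ 2)) :
    ((1 / T * Real.log (Real.pi / c) : ℝ) : EReal) ≤ escapeRate X φ {0, T} α t₀ x r := by
  have h1 : ENNReal.log (volume (orbitBall X φ {0, T} α t₀ x r) /
      volume (Metric.closedBall x r)) ≤ ((Real.log (c / Real.pi) : ℝ) : EReal) := by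
    rw [← ENNReal.log_ofReal_of_pos (by positivity), ← ofReal_div_volume_closedBall hr x]
    gcongr
  rw [escapeRate, sSup_sub_sInf_pair hT.le, EReal.neg_mul]
  have h2 : ((1 / T * Real.log (Real.pi / c) : ℝ) : EReal) =
      -(((1 / T : ℝ) : EReal) * ((Real.log (c / Real.pi) : ℝ) : EReal)) := by
    rw [← inv_div c Real.pi, Real.log_inv]
    norm_cast
    ring
  rw [h2, EReal.neg_le_neg_iff]
  exact mul_le_mul_of_nonneg_left h1 (by exact_mod_cast (by positivity : (0 : ℝ) ≤ 1 / T))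

lemma entropy_le {c : ℝ} (hT : 0 < T) (hc : 0 < c)
    (h : ∀ᶠ r in 𝓝[>] (0 : ℝ),
      ENNReal.ofReal (c * r ^ 2) ≤ volume (orbitBall X φ {0, T} α t₀ x r)) :
    entropy X φ {0, T} α t₀ x ≤ ((1 / T * Real.log (Real.pi / c) : ℝ) : EReal) := by
  refine limsup_le_of_le (by isBoundedDefault) ?_
  filter_upwards [h, self_mem_nhdsWithin] with r hr hr0
  exact escapeRate_le hT hr0 hc hr

lemma le_entropy {c : ℝ} (hT : 0 < T) (hc : 0 < c)
    (h : ∀ᶠ r in 𝓝[>] (0 : ℝ),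
      volume (orbitBall X φ {0, T} α t₀ x r) ≤ ENNReal.ofReal (c * r ^ 2)) :
    ((1 / T * Real.log (Real.pi / c) : ℝ) : EReal) ≤ entropy X φ {0, T} α t₀ x := by
  refine le_limsup_of_frequently_le (Eventually.frequently ?_) (by isBoundedDefault)
  filter_upwards [h, self_mem_nhdsWithin] with r hr hr0
  exact le_escapeRate hT hr0 hc hr

end Entropy

/-! ### Orbit balls weighted by the stretching rate -/

section WeightedField

variable {f : E 2 → E 2} {U X₀ : Set (E 2)} {T : ℝ} {x : E 2}

/-- Only two times matter: at time `0` the weight is `1`, and at time `T` it is `e^{-αT} = s⁻¹`. -/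
lemma mem_orbitBall_iff (hT : 0 < T) (hX₀ : X₀ ⊆ flowDomain f U T) (hx : x ∈ X₀) {s : ℝ}
    (hs : 0 < s) {r : ℝ} {y : E 2} :
    y ∈ orbitBall (fun s => flow f U s '' X₀) (fun t s => flow f U (t - s)) {0, T}
      (1 / T * Real.log s) 0 x r ↔
    y ∈ X₀ ∧ ‖y - x‖ ≤ r ∧ ‖flow f U T y - flow f U T x‖ ≤ s * r := by
  have h0 : ∀ z ∈ X₀, flow f U 0 z = z := fun z hz =>
    flow_zero (mem_of_mem_flowDomain (hX₀ hz))
  have himg : flow f U 0 '' X₀ = X₀ := by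
    rw [image_congr h0, image_id']
  have hexp : Real.exp (-(1 / T * Real.log s) * T) = s⁻¹ := by
    rw [show -(1 / T * Real.log s) * T = -Real.log s by field_simp, Real.exp_neg,
      Real.exp_log hs]
  simp only [orbitBall, mem_ofPred_eq, himg, orbitDist]
  refine and_congr_right fun hy => ?_
  have : Nonempty (({0, T} : Set ℝ)) := ⟨⟨0, by simp⟩⟩
  have hfin : Finite (({0, T} : Set ℝ)) := (toFinite ({0, T} : Set ℝ)).to_subtype
  rw [ciSup_le_iff (finite_range _).bddAbove]
  simp only [Subtype.forall, mem_insert_iff, mem_singleton_iff, forall_eq_or_imp, forall_eq,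
    sub_zero, h0 y hy, h0 x hx, mul_zero, Real.exp_zero, mul_one, hexp]
  rw [← div_eq_mul_inv, div_le_iff₀ hs, mul_comm r, norm_sub_rev y, norm_sub_rev (flow f U T y)]

/-- The lower volume bound at a point where the time-`T` map is differentiable: the orbit ball
contains a parallelogram with one side along `f x`. -/
lemma weightedField_le (hT : 0 < T) (hX₀ : X₀ ⊆ flowDomain f U T) (hx : X₀ ∈ 𝓝 x)
    {D : E 2 →L[ℝ] E 2} (hD : HasFDerivAt (flow f U T) D x) {s : ℝ} (hs : 0 < s)
    (hsD : ‖D (f x)‖ / ‖f x‖ = s) :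
    weightedField f U T X₀ x ≤
      ((1 / T * Real.log (Real.pi / (s / (4 * ‖D‖))) : ℝ) : EReal) := by
  have hfx : 0 < ‖f x‖ := by
    rcases (norm_nonneg (f x)).eq_or_lt with h | h
    · rw [← h, div_zero] at hsD; exact absurd hsD hs.ne
    · exact h
  have hsle : s ≤ ‖D‖ := by
    rw [← hsD, div_le_iff₀ hfx]; exact D.le_opNorm _
  have hD0 : 0 < ‖D‖ := hs.trans_le hsle
  rw [weightedField, stretchingRate, hD.fderiv, hsD]
  refine entropy_le hT (by positivity) ?_
  set v : E 2 := ‖f x‖⁻¹ • f x with hv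
  have hv1 : ‖v‖ = 1 := by rw [hv, norm_smul, norm_inv, norm_norm, inv_mul_cancel₀ hfx.ne']
  have hDv : ‖D v‖ = s := by
    rw [hv, map_smul, norm_smul, norm_inv, norm_norm, ← hsD]; ring
  clear_value v
  -- The unit vector `v` rotated by a right angle, so the parallelogram is a rectangle and its
  -- determinant factor is `1`.
  set w : E 2 := !₂[-(v 1), v 0] with hw
  have hvv : v 0 ^ 2 + v 1 ^ 2 = 1 := by
    have := EuclideanSpace.real_norm_sq_eq v
    rw [hv1, Fin.sum_univ_two] at this
    linarith
  have hw1 : ‖w‖ = 1 := by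
    have := EuclideanSpace.real_norm_sq_eq w
    rw [Fin.sum_univ_two] at this
    simp only [hw, PiLp.toLp_apply, Matrix.cons_val_zero, Matrix.cons_val_one] at this
    have h2 : ‖w‖ ^ 2 = 1 := by rw [this]; linarith
    nlinarith [norm_nonneg w]
  have hdet : v 0 * w 1 - v 1 * w 0 = 1 := by
    simp only [hw, PiLp.toLp_apply, Matrix.cons_val_zero, Matrix.cons_val_one]
    linarith
  have herr : ∀ᶠ y in 𝓝 x, ‖flow f U T y - flow f U T x - D (y - x)‖ ≤ s / 2 * ‖y - x‖ :=
    (hasFDerivAt_iff_isLittleO.1 hD).def (half_pos hs)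
  obtain ⟨R, hR, hR'⟩ := Metric.nhds_basis_closedBall.eventually_iff.1
    ((eventually_mem_set.2 hx).and herr)
  filter_upwards [self_mem_nhdsWithin, mem_nhdsWithin_of_mem_nhds (Iic_mem_nhds hR)]
    with r (hr : 0 < r) hrR
  -- Along `v` the derivative stretches by exactly `s`, along `w` by at most `‖D‖`. These half-sides
  -- keep the linear image within `s r / 2`, leaving room for the nonlinear error.
  have hvol := volume_parallelogram v w (r / 4) (r * s / (4 * ‖D‖)) (by positivity)
  rw [hdet, abs_one, one_mul] at hvol
  have hvol' : ENNReal.ofReal (s / (4 * ‖D‖) * r ^ 2) =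
      volume ((fun z => x + z) '' {z : E 2 | ∃ a b : ℝ, |a| ≤ r / 4 ∧
        |b| ≤ r * s / (4 * ‖D‖) ∧ z = a • v + b • w}) := by
    rw [image_add_left, measure_preimage_add, hvol]
    congr 1
    field_simp
  rw [hvol']
  refine measure_mono ?_
  rintro _ ⟨z, ⟨a, b, ha, hb, rfl⟩, rfl⟩
  have hb4 : |b| * ‖D‖ ≤ r * s / 4 := by
    calc |b| * ‖D‖ ≤ r * s / (4 * ‖D‖) * ‖D‖ := by gcongr
      _ = r * s / 4 := by field_simp
  have hb' : |b| ≤ r / 4 := by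
    have : |b| * s ≤ r / 4 * s := by nlinarith [abs_nonneg b]
    exact le_of_mul_le_mul_right this hs
  have hz : ‖a • v + b • w‖ ≤ r / 2 := by
    refine (norm_add_le _ _).trans ?_
    rw [norm_smul, norm_smul, hv1, hw1, Real.norm_eq_abs, Real.norm_eq_abs]
    linarith
  have hDz : ‖D (a • v + b • w)‖ ≤ s * r / 2 := by
    rw [map_add, map_smul, map_smul]
    refine (norm_add_le _ _).trans ?_
    rw [norm_smul, norm_smul, hDv, Real.norm_eq_abs, Real.norm_eq_abs]
    have h1 : ‖D w‖ ≤ ‖D‖ := by simpa [hw1] using D.le_opNorm w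
    have h2 : |b| * ‖D w‖ ≤ |b| * ‖D‖ := by gcongr
    have h3 : |a| * s ≤ r / 4 * s := by gcongr
    linarith
  have hmem := hR' (x := x + (a • v + b • w)) (by
    rw [mem_closedBall_iff_norm, add_sub_cancel_left]
    exact hz.trans ((half_le_self hr.le).trans hrR))
  rw [mem_orbitBall_iff hT hX₀ (mem_of_mem_nhds hx) hs]
  refine ⟨hmem.1, ?_, ?_⟩
  · rw [add_sub_cancel_left]; linarith
  · have h1 := hmem.2
    simp only [add_sub_cancel_left] at h1
    have h2 := norm_add_le (flow f U T (x + (a • v + b • w)) - flow f U T x -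
      D (a • v + b • w)) (D (a • v + b • w))
    rw [sub_add_cancel] at h2
    have h3 : s / 2 * ‖a • v + b • w‖ ≤ s / 2 * (r / 2) := by gcongr
    nlinarith [mul_pos hs hr]

/-- The upper volume bound at a point where the time-`T` map is differentiable: the orbit ball
is contained in a parallelogram. -/
lemma le_weightedField (hT : 0 < T) (hX₀ : X₀ ⊆ flowDomain f U T) (hx : X₀ ∈ 𝓝 x)
    {D : E 2 →L[ℝ] E 2} (hD : HasFDerivAt (flow f U T) D x) {s : ℝ} (hs : 0 < s)
    (hsD : ‖D (f x)‖ / ‖f x‖ = s) {v w : E 2} (hvw : v 0 * w 1 - v 1 * w 0 ≠ 0) {A B : ℝ}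
    (hA : 0 < A) (hB : 0 < B)
    (h : ∀ z r, ‖z‖ ≤ r → ‖D z‖ ≤ 2 * s * r →
      ∃ a b : ℝ, |a| ≤ A * r ∧ |b| ≤ B * r ∧ z = a • v + b • w) :
    ((1 / T * Real.log (Real.pi / (|v 0 * w 1 - v 1 * w 0| * (4 * A * B))) : ℝ) : EReal) ≤
      weightedField f U T X₀ x := by
  rw [weightedField, stretchingRate, hD.fderiv, hsD]
  have := abs_pos.2 hvw
  refine le_entropy hT (by positivity) ?_
  -- The nonlinear error costs at most another `s r`; hence the `2 * s * r` in the hypothesis on `D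
  -- z`.
  have herr : ∀ᶠ y in 𝓝 x, ‖flow f U T y - flow f U T x - D (y - x)‖ ≤ s * ‖y - x‖ :=
    (hasFDerivAt_iff_isLittleO.1 hD).def hs
  obtain ⟨R, hR, hR'⟩ := Metric.nhds_basis_closedBall.eventually_iff.1 herr
  filter_upwards [self_mem_nhdsWithin, mem_nhdsWithin_of_mem_nhds (Iic_mem_nhds hR)]
    with r (hr : 0 < r) hrR
  have hvol := volume_parallelogram v w (A * r) (B * r) (by positivity)
  have hvol' : ENNReal.ofReal (|v 0 * w 1 - v 1 * w 0| * (4 * A * B) * r ^ 2) =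
      volume ((fun z => x + z) '' {z : E 2 | ∃ a b : ℝ, |a| ≤ A * r ∧ |b| ≤ B * r ∧
        z = a • v + b • w}) := by
    rw [image_add_left, measure_preimage_add, hvol]
    ring_nf
  rw [hvol']
  refine measure_mono fun y hy => ?_
  rw [mem_orbitBall_iff hT hX₀ (mem_of_mem_nhds hx) hs] at hy
  refine ⟨y - x, h (y - x) r hy.2.1 ?_, by simp⟩
  have h1 := hR' (mem_closedBall_iff_norm.2 (hy.2.1.trans hrR))
  have h2 := norm_sub_le (flow f U T y - flow f U T x)
    (flow f U T y - flow f U T x - D (y - x))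
  rw [sub_sub_cancel] at h2
  have h3 : s * ‖y - x‖ ≤ s * r := by gcongr; exact hy.2.1
  linarith [hy.2.2]

/-- The weighted field is nonnegative: the orbit balls are contained in the Euclidean balls. -/
lemma weightedField_nonneg (hT : 0 < T) (hX₀ : X₀ ⊆ flowDomain f U T) (hx : x ∈ X₀)
    (hs : 0 < ‖fderiv ℝ (flow f U T) x (f x)‖ / ‖f x‖) :
    0 ≤ weightedField f U T X₀ x := by
  have h := le_entropy (X := fun s => flow f U s '' X₀) (φ := fun t s => flow f U (t - s))
    (α := stretchingRate f U x T (f x)) (t₀ := 0) (x := x) hT Real.pi_pos (by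
      filter_upwards [self_mem_nhdsWithin] with r (hr : 0 < r)
      have h1 : ENNReal.ofReal (Real.pi * r ^ 2) = volume (Metric.closedBall x r) := by
        rw [EuclideanSpace.volume_closedBall_fin_two, ← ENNReal.ofReal_pow hr.le,
          ← ENNReal.ofReal_mul (by positivity), mul_comm]
      rw [h1]
      refine measure_mono fun y hy => ?_
      rw [stretchingRate, mem_orbitBall_iff hT hX₀ hx hs] at hy
      exact mem_closedBall_iff_norm.2 hy.2.1)
  rwa [div_self Real.pi_pos.ne', Real.log_one, mul_zero, EReal.coe_zero] at h

end WeightedField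

/-! ### Eigencoordinates of the saddle -/

section Splitting

/-- Coordinates `p₁, p₂` in a basis of eigenvectors `e₁, e₂` of a hyperbolic linear map `A`. -/
structure HyperbolicSplitting (A : E 2 →L[ℝ] E 2) (l₁ l₂ : ℝ) (e₁ e₂ : E 2)
    (p₁ p₂ : E 2 →L[ℝ] ℝ) (C : ℝ) : Prop where
  pos : 0 < l₁
  neg : l₂ < 0
  norm_fst : ‖e₁‖ = 1
  norm_snd : ‖e₂‖ = 1
  decomp : ∀ z, z = p₁ z • e₁ + p₂ z • e₂
  fst_fst : p₁ e₁ = 1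
  fst_snd : p₁ e₂ = 0
  snd_fst : p₂ e₁ = 0
  snd_snd : p₂ e₂ = 1
  fst_map : ∀ z, p₁ (A z) = l₁ * p₁ z
  snd_map : ∀ z, p₂ (A z) = l₂ * p₂ z
  one_le : 1 ≤ C
  abs_fst_le : ∀ z, |p₁ z| ≤ C * ‖z‖
  abs_snd_le : ∀ z, |p₂ z| ≤ C * ‖z‖
  det_ne_zero : e₁ 0 * e₂ 1 - e₁ 1 * e₂ 0 ≠ 0
  sin_angle : ∀ z, z ≠ 0 → Real.sin (InnerProductGeometry.angle z e₂) =
    |e₁ 0 * e₂ 1 - e₁ 1 * e₂ 0| * |p₁ z| / ‖z‖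

/-- Lagrange's identity in the plane: `‖z‖²‖e‖² - ⟪z, e⟫²` is the square of the determinant. -/
lemma sin_angle_eq {z e : E 2} (hz : z ≠ 0) (he : ‖e‖ = 1) :
    Real.sin (InnerProductGeometry.angle z e) = |z 0 * e 1 - z 1 * e 0| / ‖z‖ := by
  have h := InnerProductGeometry.sin_angle_mul_norm_mul_norm z e
  rw [he, mul_one] at h
  rw [eq_div_iff (norm_pos_iff.2 hz).ne', h, ← Real.sqrt_sq_eq_abs]
  congr 1
  simp only [PiLp.inner_apply, Fin.sum_univ_two, RCLike.inner_apply, conj_trivial]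
  ring

/-- If the determinant vanished, `e₁` would equal its projection onto `e₂`, hence be an eigenvector
for both eigenvalues. -/
lemma det_eigenvectors_ne_zero {A : E 2 →L[ℝ] E 2} {l₁ l₂ : ℝ} {e₁ e₂ : E 2} (hl : l₁ ≠ l₂)
    (he₁ : ‖e₁‖ = 1) (he₂ : ‖e₂‖ = 1) (hA₁ : A e₁ = l₁ • e₁) (hA₂ : A e₂ = l₂ • e₂) :
    e₁ 0 * e₂ 1 - e₁ 1 * e₂ 0 ≠ 0 := by
  intro hd
  have h2 : e₂ 0 ^ 2 + e₂ 1 ^ 2 = 1 := by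
    have := EuclideanSpace.real_norm_sq_eq e₂
    rw [he₂, Fin.sum_univ_two] at this
    linarith
  set c := e₁ 0 * e₂ 0 + e₁ 1 * e₂ 1 with hc
  have hce : e₁ = c • e₂ := by
    ext i
    fin_cases i
    · simp [hc]; linear_combination (- e₁ 0) * h2 + e₂ 1 * hd
    · simp [hc]; linear_combination (- e₁ 1) * h2 - e₂ 0 * hd
  have h3 : (l₁ - l₂) • e₁ = 0 := by
    rw [sub_smul, ← hA₁, hce, map_smul, hA₂, smul_comm, sub_self]
  rcases smul_eq_zero.1 h3 with h | h
  · exact hl (sub_eq_zero.1 h)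
  · rw [h, norm_zero] at he₁
    exact zero_ne_one he₁

lemma exists_hyperbolicSplitting {A : E 2 →L[ℝ] E 2} {l₁ l₂ : ℝ} (hl₁ : 0 < l₁) (hl₂ : l₂ < 0)
    {e₁ e₂ : E 2} (he₁ : ‖e₁‖ = 1) (he₂ : ‖e₂‖ = 1) (hA₁ : A e₁ = l₁ • e₁)
    (hA₂ : A e₂ = l₂ • e₂) : ∃ p₁ p₂ C, HyperbolicSplitting A l₁ l₂ e₁ e₂ p₁ p₂ C := by
  have hd := det_eigenvectors_ne_zero (hl₂.trans hl₁).ne' he₁ he₂ hA₁ hA₂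
  set d := e₁ 0 * e₂ 1 - e₁ 1 * e₂ 0 with hdd
  -- Cramer's rule.
  set p₁ : E 2 →L[ℝ] ℝ :=
    d⁻¹ • (e₂ 1 • EuclideanSpace.proj 0 - e₂ 0 • EuclideanSpace.proj 1) with hp₁
  set p₂ : E 2 →L[ℝ] ℝ :=
    d⁻¹ • (e₁ 0 • EuclideanSpace.proj 1 - e₁ 1 • EuclideanSpace.proj 0) with hp₂
  have hp₁z : ∀ z, p₁ z = d⁻¹ * (e₂ 1 * z 0 - e₂ 0 * z 1) := fun z => by simp [hp₁]
  have hp₂z : ∀ z, p₂ z = d⁻¹ * (e₁ 0 * z 1 - e₁ 1 * z 0) := fun z => by simp [hp₂]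
  have dec : ∀ z, z = p₁ z • e₁ + p₂ z • e₂ := by
    intro z
    ext i
    fin_cases i
    · simp [hp₁z, hp₂z]; field_simp; rw [hdd]; ring
    · simp [hp₁z, hp₂z]; field_simp; rw [hdd]; ring
  have h11 : p₁ e₁ = 1 := by rw [hp₁z]; field_simp; rw [hdd]; ring
  have h12 : p₁ e₂ = 0 := by rw [hp₁z]; ring
  have h21 : p₂ e₁ = 0 := by rw [hp₂z]; ring
  have h22 : p₂ e₂ = 1 := by rw [hp₂z]; field_simp; rw [hdd]
  refine ⟨p₁, p₂, max 1 (max ‖p₁‖ ‖p₂‖), hl₁, hl₂, he₁, he₂, dec, h11, h12, h21, h22,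
    fun z => ?_, fun z => ?_, le_max_left _ _, fun z => ?_, fun z => ?_, hd, fun z hz => ?_⟩
  · conv_lhs => rw [dec z]
    simp [hA₁, hA₂, h11, h12, mul_comm]
  · conv_lhs => rw [dec z]
    simp [hA₁, hA₂, h21, h22, mul_comm]
  · exact (p₁.le_opNorm z).trans (mul_le_mul_of_nonneg_right
      ((le_max_left _ _).trans (le_max_right _ _)) (norm_nonneg _))
  · exact (p₂.le_opNorm z).trans (mul_le_mul_of_nonneg_right
      ((le_max_right _ _).trans (le_max_right _ _)) (norm_nonneg _))
  · rw [sin_angle_eq hz he₂, ← abs_mul, hp₁z, mul_inv_cancel_left₀ hd]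
    ring_nf

namespace HyperbolicSplitting

variable {A : E 2 →L[ℝ] E 2} {l₁ l₂ : ℝ} {e₁ e₂ : E 2} {p₁ p₂ : E 2 →L[ℝ] ℝ} {C : ℝ}

lemma norm_le (h : HyperbolicSplitting A l₁ l₂ e₁ e₂ p₁ p₂ C) (z : E 2) :
    ‖z‖ ≤ |p₁ z| + |p₂ z| := by
  conv_lhs => rw [h.decomp z]
  refine (norm_add_le _ _).trans ?_
  rw [norm_smul, norm_smul, h.norm_fst, h.norm_snd, Real.norm_eq_abs, Real.norm_eq_abs, mul_one,
    mul_one]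

lemma pos_const (h : HyperbolicSplitting A l₁ l₂ e₁ e₂ p₁ p₂ C) : 0 < C :=
  zero_lt_one.trans_le h.one_le

end HyperbolicSplitting

end Splitting

/-! ### Uniqueness of solutions -/

section Uniqueness

variable {n : ℕ} {f : E n → E n} {U : Set (E n)}

lemma exists_lipschitzOnWith_of_isCompact (hU : IsOpen U) (hf : ContDiffOn ℝ 1 f U)
    {K : Set (E n)} (hK : IsCompact K) (hKU : K ⊆ U) : ∃ C, LipschitzOnWith C f K := by
  refine LocallyLipschitzOn.exists_lipschitzOnWith_of_compact hK fun x hx => ?_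
  obtain ⟨C, t, ht, hC⟩ :=
    (hf.contDiffAt (hU.mem_nhds (hKU hx))).exists_lipschitzOnWith
  exact ⟨C, t, mem_nhdsWithin_of_mem_nhds ht, hC⟩

/-- The union of the two trajectories is a compact subset of `U`, on which the `C¹` field is
Lipschitz. -/
lemma IsSolutionOn.eqOn (hU : IsOpen U) (hf : ContDiffOn ℝ 1 f U) {γ₁ γ₂ : ℝ → E n} {t : ℝ}
    (h₁ : IsSolutionOn f U γ₁ (uIcc 0 t)) (h₂ : IsSolutionOn f U γ₂ (uIcc 0 t))
    (h0 : γ₁ 0 = γ₂ 0) : EqOn γ₁ γ₂ (uIcc 0 t) := by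
  obtain ⟨C, hC⟩ := exists_lipschitzOnWith_of_isCompact hU hf
    ((isCompact_uIcc.image_of_continuousOn h₁.continuousOn).union
      (isCompact_uIcc.image_of_continuousOn h₂.continuousOn))
    (union_subset (image_subset_iff.2 fun s hs => (h₁ s hs).1)
      (image_subset_iff.2 fun s hs => (h₂ s hs).1))
  have hm₁ : ∀ s ∈ uIcc 0 t, γ₁ s ∈ γ₁ '' uIcc 0 t ∪ γ₂ '' uIcc 0 t :=
    fun s hs => Or.inl (mem_image_of_mem _ hs)
  have hm₂ : ∀ s ∈ uIcc 0 t, γ₂ s ∈ γ₁ '' uIcc 0 t ∪ γ₂ '' uIcc 0 t :=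
    fun s hs => Or.inr (mem_image_of_mem _ hs)
  rcases le_total 0 t with ht | ht
  · rw [uIcc_of_le ht] at *
    exact ODE_solution_unique_of_mem_Icc_right (v := fun _ => f) (fun _ _ => hC)
      h₁.continuousOn h₁.hasDerivWithinAt_Ici (fun s hs => hm₁ s ⟨hs.1, hs.2.le⟩)
      h₂.continuousOn h₂.hasDerivWithinAt_Ici (fun s hs => hm₂ s ⟨hs.1, hs.2.le⟩) h0
  · rw [uIcc_of_ge ht] at *
    exact ODE_solution_unique_of_mem_Icc_left (v := fun _ => f) (fun _ _ => hC)
      h₁.continuousOn h₁.hasDerivWithinAt_Iic (fun s hs => hm₁ s ⟨hs.1.le, hs.2⟩)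
      h₂.continuousOn h₂.hasDerivWithinAt_Iic (fun s hs => hm₂ s ⟨hs.1.le, hs.2⟩) h0

/-- The value of `flow` at each time comes from a separately chosen solution; uniqueness puts all
these values on one curve. -/
lemma exists_solution_eq_flow (hU : IsOpen U) (hf : ContDiffOn ℝ 1 f U) {t : ℝ} {x : E n}
    (h : x ∈ flowDomain f U t) :
    ∃ γ : ℝ → E n, IsSolutionOn f U γ (uIcc 0 t) ∧ ∀ s ∈ uIcc 0 t, γ s = flow f U s x := by
  obtain ⟨γ, h0, hγ, -⟩ := exists_solution_of_mem_flowDomain h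
  refine ⟨γ, hγ, fun s hs => ?_⟩
  have hsub : uIcc 0 s ⊆ uIcc 0 t := uIcc_subset_uIcc left_mem_uIcc hs
  obtain ⟨γ', h0', hγ', h1⟩ :=
    exists_solution_of_mem_flowDomain (t := s) ⟨γ, h0, hγ.mono hsub⟩
  rw [h1]
  exact IsSolutionOn.eqOn hU hf (hγ.mono hsub) hγ' (by rw [h0, h0']) right_mem_uIcc

end Uniqueness

/-! ### Cone estimates for the local invariant manifolds -/

section Manifolds

variable {f : E 2 → E 2} {U : Set (E 2)} {xs : E 2} {A : E 2 →L[ℝ] E 2} {l₁ l₂ : ℝ}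
  {e₁ e₂ : E 2} {p₁ p₂ : E 2 →L[ℝ] ℝ} {C : ℝ}

/-- The quadratic form `p₁² - η² p₂²` does not decrease along solutions near a saddle. -/
lemma HyperbolicSplitting.monotoneOn_sq_sub_sq (h : HyperbolicSplitting A l₁ l₂ e₁ e₂ p₁ p₂ C)
    {κ r η : ℝ} (hκ : 0 ≤ κ) (hη1 : η ^ 2 ≤ 1) (hκ₁ : 2 * (C * κ) ≤ l₁)
    (hκ₂ : 2 * (C * κ) ≤ η ^ 2 * -l₂)
    (hf : ∀ x ∈ Metric.closedBall xs r, ‖f x - A (x - xs)‖ ≤ κ * ‖x - xs‖)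
    {γ : ℝ → E 2} {a b : ℝ} (hγ : IsSolutionOn f U γ (Icc a b))
    (hγr : ∀ t ∈ Icc a b, γ t ∈ Metric.closedBall xs r) :
    MonotoneOn (fun t => p₁ (γ t - xs) ^ 2 - η ^ 2 * p₂ (γ t - xs) ^ 2) (Icc a b) := by
  have hd : ∀ t ∈ Icc a b, HasDerivWithinAt
      (fun t => p₁ (γ t - xs) ^ 2 - η ^ 2 * p₂ (γ t - xs) ^ 2)
      (2 * p₁ (γ t - xs) * p₁ (f (γ t)) - η ^ 2 * (2 * p₂ (γ t - xs) * p₂ (f (γ t))))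
      (Icc a b) t := by
    intro t ht
    have h1 : HasDerivWithinAt (fun t => p₁ (γ t - xs)) (p₁ (f (γ t))) (Icc a b) t :=
      p₁.hasFDerivAt.comp_hasDerivWithinAt t ((hγ t ht).2.sub_const xs)
    have h2 : HasDerivWithinAt (fun t => p₂ (γ t - xs)) (p₂ (f (γ t))) (Icc a b) t :=
      p₂.hasFDerivAt.comp_hasDerivWithinAt t ((hγ t ht).2.sub_const xs)
    exact ((h1.fun_pow 2).fun_sub ((h2.fun_pow 2).const_mul (η ^ 2))).congr_deriv (by simp)
  refine monotoneOn_of_hasDerivWithinAt_nonneg (convex_Icc a b)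
    (fun t ht => (hd t ht).continuousWithinAt)
    (fun t ht => (hd t (interior_subset ht)).mono interior_subset) fun t ht => ?_
  have ht' := hγr t (interior_subset ht)
  have hR := hf _ ht'
  set z := γ t - xs
  set R := f (γ t) - A z with hRdef
  have hfz : f (γ t) = A z + R := by rw [hRdef]; abel
  rw [hfz, map_add, map_add, h.fst_map, h.snd_map]
  have hC := h.pos_const
  have hk : 0 ≤ C * κ := by positivity
  have hRz : C * ‖R‖ ≤ C * κ * (|p₁ z| + |p₂ z|) := by
    rw [mul_assoc]
    have := h.norm_le z
    gcongr
    exact hR.trans (by gcongr)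
  have h1 : |p₁ R| ≤ C * κ * (|p₁ z| + |p₂ z|) := (h.abs_fst_le R).trans hRz
  have h2 : |p₂ R| ≤ C * κ * (|p₁ z| + |p₂ z|) := (h.abs_snd_le R).trans hRz
  set k := C * κ
  set u := |p₁ z| with hu
  set v := |p₂ z| with hv
  have hu0 : 0 ≤ u := abs_nonneg _
  have hv0 : 0 ≤ v := abs_nonneg _
  have hu2 : p₁ z ^ 2 = u ^ 2 := (sq_abs _).symm
  have hv2 : p₂ z ^ 2 = v ^ 2 := (sq_abs _).symm
  have h3 : -(u * (k * (u + v))) ≤ p₁ z * p₁ R := by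
    refine (neg_le_neg ?_).trans (neg_abs_le _)
    rw [abs_mul]
    gcongr
  have h4 : p₂ z * p₂ R ≤ v * (k * (u + v)) := by
    refine (le_abs_self _).trans ?_
    rw [abs_mul]
    gcongr
  have h5 : η ^ 2 * (p₂ z * p₂ R) ≤ v * (k * (u + v)) := by
    have h6 : η ^ 2 * (p₂ z * p₂ R) ≤ η ^ 2 * (v * (k * (u + v))) := by gcongr
    have h7 : 0 ≤ v * (k * (u + v)) := by positivity
    nlinarith
  -- The two error terms together are at most `2k(u² + v²)`, which `hκ₁` and `hκ₂` allow the
  -- hyperbolic terms to absorb.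
  have h8 : (u + v) * (k * (u + v)) ≤ 2 * k * (u ^ 2 + v ^ 2) := by
    nlinarith [mul_nonneg hk (sq_nonneg (u - v))]
  have h9 : 2 * k * u ^ 2 ≤ l₁ * u ^ 2 := by gcongr
  have h10 : 2 * k * v ^ 2 ≤ η ^ 2 * -l₂ * v ^ 2 := by gcongr
  have : 2 * p₁ z * (l₁ * p₁ z + p₁ R) - η ^ 2 * (2 * p₂ z * (l₂ * p₂ z + p₂ R)) =
      2 * (l₁ * u ^ 2 + η ^ 2 * -l₂ * v ^ 2 + p₁ z * p₁ R - η ^ 2 * (p₂ z * p₂ R)) := by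
    rw [← hu2, ← hv2]; ring
  rw [this]
  nlinarith

/-- Inside the cone `p₁² ≤ p₂²` the stable coordinate decreases along solutions near a saddle. -/
lemma HyperbolicSplitting.antitoneOn_sq (h : HyperbolicSplitting A l₁ l₂ e₁ e₂ p₁ p₂ C)
    {κ r : ℝ} (hκ : 0 ≤ κ) (hκ₂ : 2 * (C * κ) ≤ -l₂)
    (hf : ∀ x ∈ Metric.closedBall xs r, ‖f x - A (x - xs)‖ ≤ κ * ‖x - xs‖)
    {γ : ℝ → E 2} {a b : ℝ} (hγ : IsSolutionOn f U γ (Icc a b))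
    (hγr : ∀ t ∈ Icc a b, γ t ∈ Metric.closedBall xs r)
    (hcone : ∀ t ∈ Icc a b, |p₁ (γ t - xs)| ≤ |p₂ (γ t - xs)|) :
    AntitoneOn (fun t => p₂ (γ t - xs) ^ 2) (Icc a b) := by
  have hd : ∀ t ∈ Icc a b, HasDerivWithinAt (fun t => p₂ (γ t - xs) ^ 2)
      (2 * p₂ (γ t - xs) * p₂ (f (γ t))) (Icc a b) t := by
    intro t ht
    have h2 : HasDerivWithinAt (fun t => p₂ (γ t - xs)) (p₂ (f (γ t))) (Icc a b) t :=
      p₂.hasFDerivAt.comp_hasDerivWithinAt t ((hγ t ht).2.sub_const xs)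
    exact (h2.fun_pow 2).congr_deriv (by simp)
  refine antitoneOn_of_hasDerivWithinAt_nonpos (convex_Icc a b)
    (fun t ht => (hd t ht).continuousWithinAt)
    (fun t ht => (hd t (interior_subset ht)).mono interior_subset) fun t ht => ?_
  have hR := hf _ (hγr t (interior_subset ht))
  have hc := hcone t (interior_subset ht)
  set z := γ t - xs
  set R := f (γ t) - A z with hRdef
  have hfz : f (γ t) = A z + R := by rw [hRdef]; abel
  rw [hfz, map_add, h.snd_map]
  have hC := h.pos_const
  have h2 : |p₂ R| ≤ C * κ * (2 * |p₂ z|) := by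
    refine (h.abs_snd_le R).trans ?_
    rw [mul_assoc]
    have := h.norm_le z
    gcongr
    exact hR.trans (by gcongr; linarith)
  have h4 : p₂ z * p₂ R ≤ |p₂ z| * (C * κ * (2 * |p₂ z|)) := by
    refine (le_abs_self _).trans ?_
    rw [abs_mul]
    gcongr
  have hv2 : p₂ z ^ 2 = |p₂ z| ^ 2 := (sq_abs _).symm
  have h10 : 2 * (C * κ) * |p₂ z| ^ 2 ≤ -l₂ * |p₂ z| ^ 2 := by gcongr
  have h11 : 2 * p₂ z * (l₂ * p₂ z + p₂ R) = 2 * (l₂ * |p₂ z| ^ 2 + p₂ z * p₂ R) := by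
    rw [← hv2]; ring
  rw [h11]
  nlinarith

/-- The form `p₁² - p₂²` is nondecreasing in time and tends to `0` as `t → -∞`, so it is nonnegative
at time `0`. -/
lemma HyperbolicSplitting.localUnstable_cone (h : HyperbolicSplitting A l₁ l₂ e₁ e₂ p₁ p₂ C)
    (hU : IsOpen U) (hfU : ContDiffOn ℝ 1 f U) {κ ρ : ℝ} (hκ : 0 ≤ κ)
    (hκ₁ : 2 * (C * κ) ≤ l₁) (hκ₂ : 2 * (C * κ) ≤ -l₂)
    (hf : ∀ x ∈ Metric.closedBall xs ρ, ‖f x - A (x - xs)‖ ≤ κ * ‖x - xs‖) {x : E 2}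
    (hx : x ∈ localUnstable f U xs (Metric.closedBall xs ρ)) :
    |p₂ (x - xs)| ≤ |p₁ (x - xs)| := by
  have hx0 : flow f U 0 x = x := flow_zero (mem_of_mem_flowDomain (hx.1 0 le_rfl).1)
  have hq : ∀ t ≤ 0, p₁ (flow f U t x - xs) ^ 2 - 1 ^ 2 * p₂ (flow f U t x - xs) ^ 2 ≤
      p₁ (x - xs) ^ 2 - 1 ^ 2 * p₂ (x - xs) ^ 2 := by
    intro t ht
    obtain ⟨γ, hγ, hγ'⟩ := exists_solution_eq_flow hU hfU (hx.1 t ht).1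
    rw [uIcc_of_ge ht] at hγ hγ'
    have := h.monotoneOn_sq_sub_sq (η := 1) hκ (by norm_num) hκ₁ (by simpa using hκ₂) hf hγ
      (fun s hs => by rw [hγ' s hs]; exact (hx.1 s hs.2).2)
      (left_mem_Icc.2 ht) (right_mem_Icc.2 ht) ht
    simpa only [hγ' t (left_mem_Icc.2 ht), hγ' 0 (right_mem_Icc.2 ht), hx0] using this
  have hlim : Tendsto (fun t => p₁ (flow f U t x - xs) ^ 2 -
      1 ^ 2 * p₂ (flow f U t x - xs) ^ 2) atBot (𝓝 0) := by
    have hc : Continuous fun y => p₁ (y - xs) ^ 2 - 1 ^ 2 * p₂ (y - xs) ^ 2 := by fun_prop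
    exact (hc.tendsto' xs 0 (by simp)).comp hx.2
  have h0 := ge_of_tendsto hlim.neg
    (eventually_atBot.2 ⟨0, fun t ht => neg_le_neg (hq t ht)⟩)
  rw [← sq_le_sq]
  linarith

/-- On orbits that stay near a saddle and tend to it, `p₁² ≤ η² p₂²`. -/
lemma HyperbolicSplitting.localStable_cone (h : HyperbolicSplitting A l₁ l₂ e₁ e₂ p₁ p₂ C)
    (hU : IsOpen U) (hfU : ContDiffOn ℝ 1 f U) {κ ρ η : ℝ} (hκ : 0 ≤ κ) (hη1 : η ^ 2 ≤ 1)
    (hκ₁ : 2 * (C * κ) ≤ l₁) (hκ₂ : 2 * (C * κ) ≤ η ^ 2 * -l₂)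
    (hf : ∀ x ∈ Metric.closedBall xs ρ, ‖f x - A (x - xs)‖ ≤ κ * ‖x - xs‖) {x : E 2}
    (hx : x ∈ localStable f U xs (Metric.closedBall xs ρ)) {t : ℝ} (ht : 0 ≤ t) :
    p₁ (flow f U t x - xs) ^ 2 ≤ η ^ 2 * p₂ (flow f U t x - xs) ^ 2 := by
  have hq : ∀ t' ≥ t, p₁ (flow f U t x - xs) ^ 2 - η ^ 2 * p₂ (flow f U t x - xs) ^ 2 ≤
      p₁ (flow f U t' x - xs) ^ 2 - η ^ 2 * p₂ (flow f U t' x - xs) ^ 2 := by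
    intro t' ht'
    obtain ⟨γ, hγ, hγ'⟩ := exists_solution_eq_flow hU hfU (hx.1 t' (ht.trans ht')).1
    rw [uIcc_of_le (ht.trans ht')] at hγ hγ'
    have := h.monotoneOn_sq_sub_sq hκ hη1 hκ₁ hκ₂ hf hγ
      (fun s hs => by rw [hγ' s hs]; exact (hx.1 s hs.1).2)
      ⟨ht, ht'⟩ (right_mem_Icc.2 (ht.trans ht')) ht'
    simpa only [hγ' t ⟨ht, ht'⟩, hγ' t' (right_mem_Icc.2 (ht.trans ht'))] using this
  have hlim : Tendsto (fun t => p₁ (flow f U t x - xs) ^ 2 -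
      η ^ 2 * p₂ (flow f U t x - xs) ^ 2) atTop (𝓝 0) := by
    have hc : Continuous fun y => p₁ (y - xs) ^ 2 - η ^ 2 * p₂ (y - xs) ^ 2 := by fun_prop
    exact (hc.tendsto' xs 0 (by simp)).comp hx.2
  have h0 := ge_of_tendsto hlim (eventually_atTop.2 ⟨t, hq⟩)
  linarith

lemma exists_closedBall_linearization (hf : HasFDerivAt f A xs) (heq : f xs = 0) {κ : ℝ}
    (hκ : 0 < κ) :
    ∃ r > 0, ∀ x ∈ Metric.closedBall xs r, ‖f x - A (x - xs)‖ ≤ κ * ‖x - xs‖ := by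
  have := (hasFDerivAt_iff_isLittleO.1 hf).def hκ
  simp only [heq, sub_zero] at this
  exact Metric.nhds_basis_closedBall.eventually_iff.1 this

/-- The local stable manifold of a saddle is tangent to `e₂`. -/
lemma HyperbolicSplitting.localStable_tangent
    (h : HyperbolicSplitting A l₁ l₂ e₁ e₂ p₁ p₂ C)
    (hU : IsOpen U) (hfU : ContDiffOn ℝ 1 f U) (hfA : HasFDerivAt f A xs) (heq : f xs = 0)
    {κ ρ η : ℝ} (hκ : 0 ≤ κ) (hκ₁ : 2 * (C * κ) ≤ l₁) (hκ₂ : 2 * (C * κ) ≤ -l₂)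
    (hf : ∀ x ∈ Metric.closedBall xs ρ, ‖f x - A (x - xs)‖ ≤ κ * ‖x - xs‖)
    (hη : 0 < η) (hη1 : η ≤ 1) :
    ∀ᶠ x in 𝓝 xs, x ∈ localStable f U xs (Metric.closedBall xs ρ) →
      |p₁ (x - xs)| ≤ η * |p₂ (x - xs)| := by
  have hC := h.pos_const
  have hl₁ := h.pos
  have hl₂ : 0 < -l₂ := neg_pos.2 h.neg
  have hη2 : η ^ 2 ≤ 1 := pow_le_one₀ hη.le hη1
  -- A narrower cone needs a smaller linearization error, hence a ball of radius `r` that may be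
  -- smaller than the given one.
  set κ' := min l₁ (η ^ 2 * -l₂) / (2 * C) with hκ'
  have hκ'0 : 0 < κ' := by positivity
  have hκ'e : 2 * (C * κ') = min l₁ (η ^ 2 * -l₂) := by rw [hκ']; field_simp
  obtain ⟨r, hr, hfr⟩ := exists_closedBall_linearization hfA heq hκ'0
  have hball : ∀ᶠ x in 𝓝 xs, 2 * (C * ‖x - xs‖) ≤ r := by
    have hc : Continuous fun x : E 2 => 2 * (C * ‖x - xs‖) := by fun_prop
    exact (hc.tendsto' xs 0 (by simp)).eventually_le_const hr
  filter_upwards [hball] with x hxr hx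
  have hx0 : flow f U 0 x = x := flow_zero (mem_of_mem_flowDomain (hx.1 0 le_rfl).1)
  have hcone : ∀ t, 0 ≤ t → |p₁ (flow f U t x - xs)| ≤ |p₂ (flow f U t x - xs)| := by
    intro t ht
    have := h.localStable_cone (η := 1) hU hfU hκ (by norm_num) hκ₁ (by simpa using hκ₂) hf hx ht
    rw [← sq_le_sq]
    linarith
  -- The orbit never leaves this ball: in the cone `|p₁| ≤ |p₂|` the norm is at most `2|p₂|`, and
  -- `|p₂|` does not increase.
  have hsmall : ∀ t, 0 ≤ t → flow f U t x ∈ Metric.closedBall xs r := by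
    intro t ht
    obtain ⟨γ, hγ, hγ'⟩ := exists_solution_eq_flow hU hfU (hx.1 t ht).1
    rw [uIcc_of_le ht] at hγ hγ'
    have hanti := h.antitoneOn_sq hκ hκ₂ hf hγ
      (fun s hs => by rw [hγ' s hs]; exact (hx.1 s hs.1).2)
      (fun s hs => by rw [hγ' s hs]; exact hcone s hs.1)
      (left_mem_Icc.2 ht) (right_mem_Icc.2 ht) ht
    simp only [hγ' t (right_mem_Icc.2 ht), hγ' 0 (left_mem_Icc.2 ht), hx0] at hanti
    rw [sq_le_sq] at hanti
    rw [mem_closedBall_iff_norm]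
    have h1 := h.norm_le (flow f U t x - xs)
    have h2 := hcone t ht
    have h3 := h.abs_snd_le (x - xs)
    linarith
  have := h.localStable_cone (ρ := r) hU hfU hκ'0.le hη2 (hκ'e.le.trans (min_le_left _ _))
    (hκ'e.le.trans (min_le_right _ _)) hfr
    ⟨fun t ht => ⟨(hx.1 t ht).1, hsmall t ht⟩, hx.2⟩ le_rfl
  rw [hx0, ← mul_pow, sq_le_sq, abs_mul, abs_of_pos hη] at this
  exact this

end Manifolds

/-! ### The linear flow and its perturbations -/

namespace HyperbolicSplitting

variable {A : E 2 →L[ℝ] E 2} {l₁ l₂ : ℝ} {e₁ e₂ : E 2} {p₁ p₂ : E 2 →L[ℝ] ℝ} {C : ℝ}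

/-- A map that is diagonal in the coordinates `p₁, p₂` is bounded below by its eigenvalues. -/
lemma le_norm_of_diagonal (h : HyperbolicSplitting A l₁ l₂ e₁ e₂ p₁ p₂ C) {L : E 2 →L[ℝ] E 2}
    {μ₁ μ₂ m : ℝ} (h₁ : ∀ z, p₁ (L z) = μ₁ * p₁ z) (h₂ : ∀ z, p₂ (L z) = μ₂ * p₂ z)
    (hm : 0 ≤ m) (hm₁ : m ≤ |μ₁|) (hm₂ : m ≤ |μ₂|) (z : E 2) :
    m / (2 * C) * ‖z‖ ≤ ‖L z‖ := by
  have hC := h.pos_const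
  have b₁ := h.abs_fst_le (L z)
  have b₂ := h.abs_snd_le (L z)
  rw [h₁, abs_mul] at b₁
  rw [h₂, abs_mul] at b₂
  have c₁ : m * |p₁ z| ≤ |μ₁| * |p₁ z| := by gcongr
  have c₂ : m * |p₂ z| ≤ |μ₂| * |p₂ z| := by gcongr
  have c₃ : m * ‖z‖ ≤ m * (|p₁ z| + |p₂ z|) := by gcongr; exact h.norm_le z
  rw [div_mul_eq_mul_div, div_le_iff₀ (by positivity)]
  linarith

/-- A map that is diagonal in the coordinates `p₁, p₂` is bounded above by its eigenvalues. -/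
lemma norm_le_of_diagonal (h : HyperbolicSplitting A l₁ l₂ e₁ e₂ p₁ p₂ C) {L : E 2 →L[ℝ] E 2}
    {μ₁ μ₂ M : ℝ} (h₁ : ∀ z, p₁ (L z) = μ₁ * p₁ z) (h₂ : ∀ z, p₂ (L z) = μ₂ * p₂ z)
    (hM₁ : |μ₁| ≤ M) (hM₂ : |μ₂| ≤ M) (z : E 2) :
    ‖L z‖ ≤ 2 * C * M * ‖z‖ := by
  have hM : 0 ≤ M := (abs_nonneg _).trans hM₁
  have c₃ := h.norm_le (L z)
  rw [h₁, h₂, abs_mul, abs_mul] at c₃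
  have c₁ : |μ₁| * |p₁ z| ≤ M * (C * ‖z‖) := by gcongr; exact h.abs_fst_le z
  have c₂ : |μ₂| * |p₂ z| ≤ M * (C * ‖z‖) := by gcongr; exact h.abs_snd_le z
  linarith

/-- Bounds for the speed and its stretching under a perturbation `D` of a diagonal map `L`. -/
lemma stretching_bounds (h : HyperbolicSplitting A l₁ l₂ e₁ e₂ p₁ p₂ C) {L D : E 2 →L[ℝ] E 2}
    {μ₁ μ₂ m M η : ℝ} (h₁ : ∀ z, p₁ (L z) = μ₁ * p₁ z) (h₂ : ∀ z, p₂ (L z) = μ₂ * p₂ z)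
    (hμ₂ : 0 < μ₂) (hμ : μ₂ ≤ μ₁) (hm : 0 < m) (hm₁ : m ≤ l₁) (hm₂ : m ≤ -l₂) (hM₁ : l₁ ≤ M)
    (hM₂ : -l₂ ≤ M) (hη₁ : η ≤ m / (4 * C)) (hη₂ : η ≤ μ₂ / (4 * C))
    (hD : ‖D - L‖ ≤ η) {v z : E 2} (hv : ‖v - A z‖ ≤ η * ‖z‖) :
    m / (4 * C) * ‖z‖ ≤ ‖v‖ ∧ ‖v‖ ≤ 3 * M * C * ‖z‖ ∧ ‖D‖ ≤ 3 * C * μ₁ ∧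
      μ₂ / (4 * C) * ‖v‖ ≤ ‖D v‖ ∧
      ‖D v - L (A z)‖ ≤ η * (2 * C * μ₁ + 3 * M * C) * ‖z‖ := by
  have hC := h.pos_const
  have hC1 := h.one_le
  have hl₁ := h.pos
  have hl₂ := h.neg
  have hη : 0 ≤ η := (norm_nonneg _).trans hD
  have hM : 0 < M := hl₁.trans_le hM₁
  have hμ₁ : 0 < μ₁ := hμ₂.trans_le hμ
  have hz := norm_nonneg z
  have hA₁ := h.le_norm_of_diagonal h.fst_map h.snd_map hm.le
    (by rwa [abs_of_pos hl₁]) (by rwa [abs_of_neg hl₂]) z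
  have hA₂ := h.norm_le_of_diagonal h.fst_map h.snd_map (M := M)
    (by rwa [abs_of_pos hl₁]) (by rwa [abs_of_neg hl₂]) z
  have hL₁ := h.le_norm_of_diagonal h₁ h₂ hμ₂.le (by rwa [abs_of_pos hμ₁])
    (by rw [abs_of_pos hμ₂]) v
  have hL₂ := h.norm_le_of_diagonal h₁ h₂ (M := μ₁) (by rw [abs_of_pos hμ₁])
    (by rwa [abs_of_pos hμ₂])
  have hLn : ‖L‖ ≤ 2 * C * μ₁ := L.opNorm_le_bound (by positivity) hL₂
  have hηM : η ≤ M * C := by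
    refine hη₁.trans ((div_le_self hm.le (by linarith)).trans ?_)
    nlinarith
  have hημ : η ≤ C * μ₁ := by
    refine hη₂.trans ((div_le_self hμ₂.le (by linarith)).trans ?_)
    nlinarith
  -- The error consumes at most half of the lower bound `m / (2C)` for `A`; the lower bound on `‖D
  -- v‖` is obtained in the same way.
  have hv1 : m / (4 * C) * ‖z‖ ≤ ‖v‖ := by
    have h3 := norm_le_norm_add_norm_sub' (A z) v
    rw [norm_sub_rev] at h3
    have h4 : η * ‖z‖ ≤ m / (4 * C) * ‖z‖ := by gcongr
    have h5 : m / (2 * C) * ‖z‖ = m / (4 * C) * ‖z‖ + m / (4 * C) * ‖z‖ := by field_simp; ring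
    linarith
  have hv2 : ‖v‖ ≤ 3 * M * C * ‖z‖ := by
    have h3 := norm_le_norm_add_norm_sub' v (A z)
    have h4 : η * ‖z‖ ≤ M * C * ‖z‖ := by gcongr
    linarith
  have hDLv : ‖(D - L) v‖ ≤ η * ‖v‖ := (D - L).le_of_opNorm_le hD v
  refine ⟨hv1, hv2, ?_, ?_, ?_⟩
  · have h3 := norm_le_norm_add_norm_sub' D L
    linarith
  · have h3 := norm_le_norm_add_norm_sub' (L v) (D v)
    rw [norm_sub_rev, ← _root_.sub_apply] at h3
    have h4 : η * ‖v‖ ≤ μ₂ / (4 * C) * ‖v‖ := by gcongr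
    have h5 : μ₂ / (2 * C) * ‖v‖ = μ₂ / (4 * C) * ‖v‖ + μ₂ / (4 * C) * ‖v‖ := by
      field_simp; ring
    linarith
  · have h3 : D v - L (A z) = (D - L) v + L (v - A z) := by
      simp only [_root_.sub_apply, map_sub]; abel
    rw [h3]
    have h4 : ‖L (v - A z)‖ ≤ 2 * C * μ₁ * (η * ‖z‖) := (hL₂ _).trans (by gcongr)
    have h5 : η * ‖v‖ ≤ η * (3 * M * C * ‖z‖) := by gcongr
    refine (norm_add_le _ _).trans ?_
    linarith

/-- The flow of the linear equation `z' = A z`. -/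
lemma exists_linear_flow (h : HyperbolicSplitting A l₁ l₂ e₁ e₂ p₁ p₂ C) :
    ∃ Φ : ℝ → E 2 →L[ℝ] E 2, Φ 0 = 1 ∧ (∀ t, HasDerivAt Φ (A * Φ t) t) ∧
      (∀ t, Φ t * Φ (-t) = 1) ∧ (∀ t z, p₁ (Φ t z) = Real.exp (l₁ * t) * p₁ z) ∧
      ∀ t z, p₂ (Φ t z) = Real.exp (l₂ * t) * p₂ z := by
  have hinj : ∀ y z : E 2, p₁ y = p₁ z → p₂ y = p₂ z → y = z := by
    intro y z h₁ h₂
    rw [h.decomp y, h.decomp z, h₁, h₂]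
  set Φ : ℝ → E 2 →L[ℝ] E 2 := fun t =>
    Real.exp (l₁ * t) • p₁.smulRight e₁ + Real.exp (l₂ * t) • p₂.smulRight e₂ with hΦ
  have hp₁ : ∀ t z, p₁ (Φ t z) = Real.exp (l₁ * t) * p₁ z := fun t z => by
    simp [hΦ, h.fst_fst, h.fst_snd]
  have hp₂ : ∀ t z, p₂ (Φ t z) = Real.exp (l₂ * t) * p₂ z := fun t z => by
    simp [hΦ, h.snd_fst, h.snd_snd]
  refine ⟨Φ, ?_, fun t => ?_, fun t => ?_, hp₁, hp₂⟩
  · ext1 z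
    exact hinj _ _ (by simp [hp₁]) (by simp [hp₂])
  · have hexp : ∀ l : ℝ, HasDerivAt (fun t => Real.exp (l * t)) (Real.exp (l * t) * l) t :=
      fun l => by simpa using ((hasDerivAt_id t).const_mul l).exp
    refine (((hexp l₁).smul_const (p₁.smulRight e₁)).fun_add
      ((hexp l₂).smul_const (p₂.smulRight e₂))).congr_deriv ?_
    ext1 z
    refine hinj _ _ ?_ ?_
    · rw [mul_apply_eq_comp, h.fst_map, hp₁]
      simp [h.fst_fst, h.fst_snd]; ring
    · rw [mul_apply_eq_comp, h.snd_map, hp₂]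
      simp [h.snd_fst, h.snd_snd]; ring
  · ext1 z
    refine hinj _ _ ?_ ?_
    · rw [mul_apply_eq_comp, hp₁, hp₁, ← mul_assoc, ← Real.exp_add]; simp
    · rw [mul_apply_eq_comp, hp₂, hp₂, ← mul_assoc, ← Real.exp_add]; simp

end HyperbolicSplitting

lemma one_div_mul_log_lt {T X c k a : ℝ} (hT : 0 < T) (hX : 0 < X) (hc : 0 < c)
    (hXc : X ≤ c * Real.exp (k * T)) (h : Real.log c < a * T) :
    1 / T * Real.log X < k + a := by
  have h1 := Real.log_le_log hX hXc
  rw [Real.log_mul hc.ne' (Real.exp_pos _).ne', Real.log_exp] at h1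
  rw [one_div_mul_eq_div, div_lt_iff₀ hT]
  linarith

lemma lt_one_div_mul_log {T X c k a : ℝ} (hT : 0 < T) (hc : 0 < c)
    (hXc : c * Real.exp (k * T) ≤ X) (h : -Real.log c < a * T) :
    k - a < 1 / T * Real.log X := by
  have h1 := Real.log_le_log (by positivity) hXc
  rw [Real.log_mul hc.ne' (Real.exp_pos _).ne', Real.log_exp] at h1
  rw [one_div_mul_eq_div, lt_div_iff₀ hT]
  linarith

/-! ### Entropy bounds in the cones -/

section Bounds

variable {f : E 2 → E 2} {U X₀ : Set (E 2)} {T : ℝ} {x xs : E 2}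
  {A : E 2 →L[ℝ] E 2} {l₁ l₂ : ℝ} {e₁ e₂ : E 2} {p₁ p₂ : E 2 →L[ℝ] ℝ} {C : ℝ}

lemma weightedField_lt (hT : 0 < T) (hX₀ : X₀ ⊆ flowDomain f U T) (hx : X₀ ∈ 𝓝 x)
    {D : E 2 →L[ℝ] E 2} (hD : HasFDerivAt (flow f U T) D x) {s B c k a : ℝ} (hs : 0 < s)
    (hsD : s * ‖f x‖ ≤ ‖D (f x)‖) (hfx : f x ≠ 0) (hB : ‖D‖ ≤ B) (hc : 0 < c)
    (hBc : 4 * Real.pi * B ≤ c * Real.exp (k * T) * s) (hca : Real.log c < a * T) :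
    weightedField f U T X₀ x < ((k + a : ℝ) : EReal) := by
  have hfx' : 0 < ‖f x‖ := norm_pos_iff.2 hfx
  set s' := ‖D (f x)‖ / ‖f x‖ with hs'
  have hss' : s ≤ s' := by rwa [hs', le_div_iff₀ hfx']
  have hs'0 : 0 < s' := hs.trans_le hss'
  have hD0 : 0 < ‖D‖ := by
    have := D.le_opNorm (f x)
    have h2 : s * ‖f x‖ ≤ ‖D‖ * ‖f x‖ := hsD.trans this
    exact hs.trans_le (le_of_mul_le_mul_right h2 hfx')
  refine (weightedField_le hT hX₀ hx hD hs'0 rfl).trans_lt ?_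
  rw [EReal.coe_lt_coe_iff]
  refine one_div_mul_log_lt hT (by positivity) hc ?_ hca
  have h1 : Real.pi / (s' / (4 * ‖D‖)) = 4 * Real.pi * ‖D‖ / s' := by field_simp
  rw [h1, div_le_iff₀ hs'0]
  have h2 : c * Real.exp (k * T) * s ≤ c * Real.exp (k * T) * s' := by gcongr
  have h3 : 4 * Real.pi * ‖D‖ ≤ 4 * Real.pi * B := by gcongr
  linarith

end Bounds

section Bounds

variable {f : E 2 → E 2} {U X₀ : Set (E 2)} {T : ℝ} {x xs : E 2}
  {A : E 2 →L[ℝ] E 2} {l₁ l₂ : ℝ} {e₁ e₂ : E 2} {p₁ p₂ : E 2 →L[ℝ] ℝ} {C : ℝ}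

/-- The bounds for the weighted field at a point near a saddle, with explicit constants: `L` is the
time-`T` map of the linearization and `D` the derivative of the time-`T` map at `x`. -/
lemma HyperbolicSplitting.weightedField_bounds
    (h : HyperbolicSplitting A l₁ l₂ e₁ e₂ p₁ p₂ C) {L D : E 2 →L[ℝ] E 2}
    {m M η ε d K : ℝ} (h₁ : ∀ z, p₁ (L z) = Real.exp (l₁ * T) * p₁ z)
    (h₂ : ∀ z, p₂ (L z) = Real.exp (l₂ * T) * p₂ z)
    (hm : 0 < m) (hm₁ : m ≤ l₁) (hm₂ : m ≤ -l₂) (hM₁ : l₁ ≤ M) (hM₂ : -l₂ ≤ M)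
    (hd : d = |e₁ 0 * e₂ 1 - e₁ 1 * e₂ 0|) (hK : K = (M * (M / d + C) + 1) * (4 * C) / m)
    (hεM : ε ≤ M)
    (hη₁ : η ≤ m / (4 * C)) (hη₂ : η ≤ Real.exp (l₂ * T) / (4 * C))
    (hη₃ : η * (2 * C * Real.exp (l₁ * T) + 3 * M * C) ≤ Real.exp (l₂ * T))
    (hη₄ : η * (2 * C * Real.exp (l₁ * T) + 3 * M * C) ≤
      Real.exp (l₁ * T) * l₁ * Real.exp (-(ε / 4) * T) / (2 * C * d))
    (hT : 0 < T) (hX₀ : X₀ ⊆ flowDomain f U T) (hx : X₀ ∈ 𝓝 x)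
    (hD : HasFDerivAt (flow f U T) D x) (hDL : ‖D - L‖ ≤ η)
    (hv : ‖f x - A (x - xs)‖ ≤ η * ‖x - xs‖) (hxs : x ≠ xs)
    (hT₁ : Real.log (48 * Real.pi * C ^ 2) < ε * T)
    (hT₂ : Real.log (72 * Real.pi * M * C ^ 3 * d / l₁) < 3 / 4 * ε * T)
    (hT₃ : -Real.log (Real.pi / (4 * d * C ^ 2 * (2 * K + 1))) < ε * T) :
    f x ≠ 0 ∧ 0 ≤ weightedField f U T X₀ x ∧
      weightedField f U T X₀ x < ((l₁ - l₂ + ε : ℝ) : EReal) ∧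
      (x ∈ unstableCone xs e₂ ε T → weightedField f U T X₀ x < (ε : EReal)) ∧
      (x ∈ stableCone xs e₂ l₁ l₂ ε T →
        ((l₁ - l₂ - ε : ℝ) : EReal) < weightedField f U T X₀ x) := by
  have hC := h.pos_const
  have hl₁ := h.pos
  have hl₂ := h.neg
  have hM : 0 < M := hl₁.trans_le hM₁
  have hd0 : 0 < d := hd ▸ abs_pos.2 h.det_ne_zero
  have hK0 : 0 < K := by rw [hK]; positivity
  have hz0 : x - xs ≠ 0 := sub_ne_zero.2 hxs
  have hz : 0 < ‖x - xs‖ := norm_pos_iff.2 hz0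
  have hsin := h.sin_angle (x - xs) hz0
  rw [← hd] at hsin
  have hquot : Real.exp ((l₁ - l₂) * T) * Real.exp (l₂ * T) = Real.exp (l₁ * T) := by
    rw [← Real.exp_add]; ring_nf
  have hquot' : Real.exp ((l₂ - l₁) * T) * Real.exp (l₁ * T) = Real.exp (l₂ * T) := by
    rw [← Real.exp_add]; ring_nf
  have hqq : Real.exp (ε / 4 * T) * Real.exp (-(ε / 4) * T) = 1 := by
    rw [← Real.exp_add]; simp
  have hμ₁ := Real.exp_pos (l₁ * T)
  have hμ₂ := Real.exp_pos (l₂ * T)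
  have hq := Real.exp_pos (-(ε / 4) * T)
  have hμ : Real.exp (l₂ * T) ≤ Real.exp (l₁ * T) := by
    have := hl₂.trans hl₁
    gcongr
  obtain ⟨b₁, b₂, b₃, b₄, b₅⟩ := h.stretching_bounds h₁ h₂ hμ₂ hμ hm hm₁ hm₂ hM₁ hM₂ hη₁ hη₂
    hDL hv
  simp only [unstableCone, stableCone, mem_ofPred_eq, hsin]
  clear hsin
  set z := x - xs with hzdef
  set μ₁ := Real.exp (l₁ * T)
  set μ₂ := Real.exp (l₂ * T)
  set q := Real.exp (-(ε / 4) * T)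
  have hfx : 0 < ‖f x‖ := lt_of_lt_of_le (by positivity) b₁
  have hfx0 : f x ≠ 0 := norm_pos_iff.1 hfx
  have hs0 : 0 < ‖D (f x)‖ := lt_of_lt_of_le (by positivity) b₄
  refine ⟨hfx0, ?_, ?_, fun hcone => ?_, fun hcone => ?_⟩
  · exact weightedField_nonneg hT hX₀ (mem_of_mem_nhds hx) (by rw [hD.fderiv]; positivity)
  · refine weightedField_lt hT hX₀ hx hD (s := μ₂ / (4 * C)) (by positivity) b₄ hfx0 b₃
      (by positivity) (le_of_eq ?_) hT₁
    rw [← hquot]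
    field_simp
    ring
  -- The cone makes the unstable component of `L (A z)` large. The factor `2` in the cone's
  -- definition gives twice the quantity in `hη₄`, so half remains after the perturbation.
  · have ha : 2 * q * ‖z‖ ≤ d * |p₁ z| := (le_div_iff₀ hz).1 hcone.2
    have h3 : μ₁ * (l₁ * |p₁ z|) ≤ C * ‖L (A z)‖ := by
      have := h.abs_fst_le (L (A z))
      rwa [h₁, h.fst_map, abs_mul, abs_mul, abs_of_pos hμ₁, abs_of_pos hl₁] at this
    have h4 : μ₁ * l₁ * q / (2 * C * d) * ‖z‖ + μ₁ * l₁ * q / (2 * C * d) * ‖z‖ ≤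
        ‖L (A z)‖ := by
      have h5 : μ₁ * l₁ * (2 * q * ‖z‖) ≤ μ₁ * l₁ * (d * |p₁ z|) := by gcongr
      have h6 : d * (μ₁ * (l₁ * |p₁ z|)) ≤ d * (C * ‖L (A z)‖) := by gcongr
      have h7 : μ₁ * l₁ * q / (2 * C * d) * ‖z‖ + μ₁ * l₁ * q / (2 * C * d) * ‖z‖ =
          μ₁ * l₁ * q * ‖z‖ / (C * d) := by field_simp; ring
      rw [h7, div_le_iff₀ (by positivity)]
      have h8 : 0 ≤ μ₁ * l₁ * q * ‖z‖ := by positivity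
      linarith
    have h5 : ‖D (f x) - L (A z)‖ ≤ μ₁ * l₁ * q / (2 * C * d) * ‖z‖ :=
      b₅.trans (by gcongr)
    have h6 : μ₁ * l₁ * q / (2 * C * d) * ‖z‖ ≤ ‖D (f x)‖ := by
      have := norm_le_norm_add_norm_sub' (L (A z)) (D (f x))
      rw [norm_sub_rev] at this
      linarith
    have h7 := weightedField_lt hT hX₀ hx hD (s := μ₁ * l₁ * q / (2 * C * d) / (3 * M * C))
      (B := 3 * C * μ₁) (c := 72 * Real.pi * M * C ^ 3 * d / l₁) (k := ε / 4) (a := 3 / 4 * ε)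
      (by positivity) ?_ hfx0 b₃ (by positivity) (le_of_eq ?_) hT₂
    · rwa [show ε / 4 + 3 / 4 * ε = ε by ring] at h7
    · refine le_trans ?_ h6
      rw [div_mul_eq_mul_div, div_le_iff₀ (by positivity)]
      calc _ ≤ μ₁ * l₁ * q / (2 * C * d) * (3 * M * C * ‖z‖) := by gcongr
        _ = _ := by ring
    · have h8 : Real.exp (ε / 4 * T) = q⁻¹ := eq_inv_of_mul_eq_one_left hqq
      rw [h8]
      field_simp
      ring
  -- In the stable cone the factor `e^{(l₂-l₁)T}` offsets the growth `e^{l₁T}`, so both components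
  -- of `L (A z)` are of order `e^{l₂T}` and `s ≤ K e^{l₂T}`.
  · have ha : d * |p₁ z| ≤ ε / 4 * Real.exp ((l₂ - l₁) * T) * ‖z‖ := (div_le_iff₀ hz).1 hcone.2
    have ha' : μ₁ * |p₁ z| ≤ M / d * μ₂ * ‖z‖ := by
      rw [div_mul_eq_mul_div, div_mul_eq_mul_div, le_div_iff₀ hd0]
      calc μ₁ * |p₁ z| * d = μ₁ * (d * |p₁ z|) := by ring
        _ ≤ μ₁ * (ε / 4 * Real.exp ((l₂ - l₁) * T) * ‖z‖) := by gcongr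
        _ = ε / 4 * μ₂ * ‖z‖ := by rw [← hquot']; ring
        _ ≤ M * μ₂ * ‖z‖ := by gcongr; linarith
    have h3 : ‖L (A z)‖ ≤ M * (M / d + C) * μ₂ * ‖z‖ := by
      have h4 := h.norm_le (L (A z))
      rw [h₁, h₂, h.fst_map, h.snd_map] at h4
      simp only [abs_mul, abs_of_pos hμ₁, abs_of_pos hμ₂, abs_of_pos hl₁, abs_of_neg hl₂] at h4
      have h5 : l₁ * (μ₁ * |p₁ z|) ≤ M * (M / d * μ₂ * ‖z‖) := by gcongr
      have h6 : -l₂ * (μ₂ * |p₂ z|) ≤ M * (μ₂ * (C * ‖z‖)) := by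
        gcongr
        exact h.abs_snd_le z
      calc _ ≤ _ := h4
        _ = l₁ * (μ₁ * |p₁ z|) + -l₂ * (μ₂ * |p₂ z|) := by ring
        _ ≤ M * (M / d * μ₂ * ‖z‖) + M * (μ₂ * (C * ‖z‖)) := add_le_add h5 h6
        _ = _ := by ring
    have h4 : ‖D (f x)‖ ≤ (M * (M / d + C) + 1) * μ₂ * ‖z‖ := by
      have h5 := norm_le_norm_add_norm_sub' (D (f x)) (L (A z))
      have h6 : η * (2 * C * μ₁ + 3 * M * C) * ‖z‖ ≤ μ₂ * ‖z‖ := by gcongr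
      linarith
    set s := ‖D (f x)‖ / ‖f x‖ with hs
    have hs' : 0 < s := by positivity
    have hsK : s ≤ K * μ₂ := by
      rw [hs, div_le_iff₀ hfx]
      refine h4.trans ?_
      calc (M * (M / d + C) + 1) * μ₂ * ‖z‖ = K * μ₂ * (m / (4 * C) * ‖z‖) := by
            rw [hK]; field_simp
        _ ≤ _ := by gcongr
    have hημ : η ≤ μ₂ := hη₂.trans (div_le_self hμ₂.le (by linarith [h.one_le]))
    -- If `‖D y‖ ≤ 2 s r`, then `‖L y‖ ≤ (2K + 1) μ₂ r`; dividing its unstable component by `μ₁`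
    -- bounds `p₁ y`.
    refine lt_of_lt_of_le ?_ (le_weightedField hT hX₀ hx hD hs' rfl h.det_ne_zero
      (A := C * (2 * K + 1) * (μ₂ / μ₁)) (B := C) (by positivity) hC fun y r hy hDy =>
        ⟨p₁ y, p₂ y, ?_, ?_, h.decomp y⟩)
    · rw [EReal.coe_lt_coe_iff, ← hd]
      refine lt_one_div_mul_log hT (c := Real.pi / (4 * d * C ^ 2 * (2 * K + 1)))
        (by positivity) (le_of_eq ?_) hT₃
      have h5 : Real.exp ((l₁ - l₂) * T) = μ₁ / μ₂ := by rw [← hquot]; field_simp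
      rw [h5]
      field_simp
    · have hr : 0 ≤ r := (norm_nonneg _).trans hy
      have h5 := h.abs_fst_le (L y)
      rw [h₁, abs_mul, abs_of_pos hμ₁] at h5
      have h6 := norm_le_norm_add_norm_sub' (L y) (D y)
      rw [norm_sub_rev, ← _root_.sub_apply] at h6
      have h7 : ‖(D - L) y‖ ≤ μ₂ * r :=
        ((D - L).le_of_opNorm_le (hDL.trans hημ) y).trans (by gcongr)
      have h8 : 2 * s * r ≤ 2 * (K * μ₂) * r := by gcongr
      have h9 : C * ‖L y‖ ≤ C * ((2 * K + 1) * μ₂ * r) := by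
        gcongr
        linarith
      have h10 : C * (2 * K + 1) * (μ₂ / μ₁) * r = C * ((2 * K + 1) * μ₂ * r) / μ₁ := by
        field_simp
      rw [h10, le_div_iff₀ hμ₁]
      linarith
    · exact (h.abs_snd_le y).trans (by gcongr)

/-- The local unstable manifold lies in the unstable cone. -/
lemma HyperbolicSplitting.mem_unstableCone (h : HyperbolicSplitting A l₁ l₂ e₁ e₂ p₁ p₂ C)
    {ε : ℝ} (hxs : x ≠ xs) (hp : |p₂ (x - xs)| ≤ |p₁ (x - xs)|)
    (hT : 2 * Real.exp (-(ε / 4) * T) ≤ |e₁ 0 * e₂ 1 - e₁ 1 * e₂ 0| / 2) :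
    x ∈ unstableCone xs e₂ ε T := by
  have hz : 0 < ‖x - xs‖ := norm_pos_iff.2 (sub_ne_zero.2 hxs)
  refine ⟨hxs, hT.trans ?_⟩
  rw [h.sin_angle _ (sub_ne_zero.2 hxs), le_div_iff₀ hz]
  have h1 := h.norm_le (x - xs)
  have h2 : |e₁ 0 * e₂ 1 - e₁ 1 * e₂ 0| * ‖x - xs‖ ≤
      |e₁ 0 * e₂ 1 - e₁ 1 * e₂ 0| * (2 * |p₁ (x - xs)|) := by
    gcongr
    linarith
  linarith

/-- Points whose unstable coordinate is small compared to the stable one lie in the stable cone. -/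
lemma HyperbolicSplitting.mem_stableCone (h : HyperbolicSplitting A l₁ l₂ e₁ e₂ p₁ p₂ C)
    {ε θ : ℝ} (hxs : x ≠ xs) (hθ : 0 ≤ θ) (hp : |p₁ (x - xs)| ≤ θ * |p₂ (x - xs)|)
    (hT : |e₁ 0 * e₂ 1 - e₁ 1 * e₂ 0| * (θ * C) ≤ ε / 4 * Real.exp ((l₂ - l₁) * T)) :
    x ∈ stableCone xs e₂ l₁ l₂ ε T := by
  have hz : 0 < ‖x - xs‖ := norm_pos_iff.2 (sub_ne_zero.2 hxs)
  refine ⟨hxs, le_trans ?_ hT⟩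
  rw [h.sin_angle _ (sub_ne_zero.2 hxs), div_le_iff₀ hz]
  have h1 : |p₁ (x - xs)| ≤ θ * (C * ‖x - xs‖) := hp.trans (by gcongr; exact h.abs_snd_le _)
  calc _ ≤ |e₁ 0 * e₂ 1 - e₁ 1 * e₂ 0| * (θ * (C * ‖x - xs‖)) := by gcongr
    _ = _ := by ring

end Bounds

end FTME

theorem theorem4p2
    (U : Set (FTME.E 2)) (hU : IsOpen U)
    (f : FTME.E 2 → FTME.E 2) (hf : ContDiffOn ℝ 2 f U)
    (xs : FTME.E 2) (hxs : xs ∈ U) (heq : f xs = 0)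
    (l₁ l₂ : ℝ) (hl₁ : 0 < l₁) (hl₂ : l₂ < 0)
    (e₁ e₂ : FTME.E 2) (he₁ : ‖e₁‖ = 1) (he₂ : ‖e₂‖ = 1)
    (hA₁ : fderiv ℝ f xs e₁ = l₁ • e₁) (hA₂ : fderiv ℝ f xs e₂ = l₂ • e₂) :
    ∃ ρ : ℝ, 0 < ρ ∧
    ∀ ε : ℝ, 0 < ε → ε < min l₁ (-l₂) →
    ∃ T₀ : ℝ, 0 < T₀ ∧ ∀ T : ℝ, T₀ ≤ T →
    ∀ X₀ : Set (FTME.E 2), X₀ ⊆ FTME.flowDomain f U T → X₀ ∈ 𝓝 xs →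
    ∃ δ : ℝ, 0 < δ ∧
      -- the field is well defined on the punctured ball
      Metric.closedBall xs δ ⊆ X₀ ∧
      (∀ x ∈ Metric.closedBall xs δ \ {xs}, f x ≠ 0) ∧
      -- (i) bound for the weighted field
      (∀ x ∈ Metric.closedBall xs δ \ {xs},
        FTME.weightedField f U T X₀ x ∈ Set.Ico (0 : EReal) ((l₁ - l₂ + ε : ℝ) : EReal)) ∧
      -- (ii) unstable cone
      (FTME.localUnstable f U xs (Metric.closedBall xs ρ) ∩ Metric.closedBall xs δ) \ {xs} ⊆
        FTME.unstableCone xs e₂ ε T ∧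
      (∀ x ∈ FTME.unstableCone xs e₂ ε T ∩ Metric.closedBall xs δ,
        FTME.weightedField f U T X₀ x ∈ Set.Ico (0 : EReal) (ε : EReal)) ∧
      -- (iii) stable cone
      (FTME.localStable f U xs (Metric.closedBall xs ρ) ∩ Metric.closedBall xs δ) \ {xs} ⊆
        FTME.stableCone xs e₂ l₁ l₂ ε T ∧
      (∀ x ∈ FTME.stableCone xs e₂ l₁ l₂ ε T ∩ Metric.closedBall xs δ,
        ((l₁ - ε : ℝ) : EReal) < FTME.weightedField f U T X₀ x) ∧
      (∀ x ∈ (FTME.localStable f U xs (Metric.closedBall xs ρ) ∩ Metric.closedBall xs δ) \ {xs},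
        FTME.weightedField f U T X₀ x ∈
          Set.Ioo ((l₁ - l₂ - ε : ℝ) : EReal) ((l₁ - l₂ + ε : ℝ) : EReal)) := by
  have hfx : ContDiffAt ℝ 2 f xs := hf.contDiffAt (hU.mem_nhds hxs)
  have hf1 : ContDiffOn ℝ 1 f U := hf.of_le (by norm_num)
  have hfd : HasFDerivAt f (fderiv ℝ f xs) xs :=
    (hfx.differentiableAt (by norm_num)).hasFDerivAt
  obtain ⟨p₁, p₂, C, h⟩ := FTME.exists_hyperbolicSplitting hl₁ hl₂ he₁ he₂ hA₁ hA₂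
  obtain ⟨Φ, hΦ0, hΦ, hΦΨ, hΦ₁, hΦ₂⟩ := h.exists_linear_flow
  have hC := h.pos_const
  have hl₂' : 0 < -l₂ := neg_pos.2 hl₂
  set m := min l₁ (-l₂) with hm
  set M := max l₁ (-l₂) with hM
  have hm0 : 0 < m := lt_min hl₁ hl₂'
  have hmM : m ≤ M := min_le_max
  have hM0 : 0 < M := hm0.trans_le hmM
  set d := |e₁ 0 * e₂ 1 - e₁ 1 * e₂ 0| with hd
  have hd0 : 0 < d := abs_pos.2 h.det_ne_zero
  set κ := m / (2 * C) with hκ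
  have hκ0 : 0 < κ := by positivity
  have hκm : 2 * (C * κ) = m := by rw [hκ]; field_simp
  have hκ₁ : 2 * (C * κ) ≤ l₁ := hκm.le.trans (min_le_left _ _)
  have hκ₂ : 2 * (C * κ) ≤ -l₂ := hκm.le.trans (min_le_right _ _)
  -- `ρ` only has to serve the cone of opening `η = 1`, so it is independent of `ε` and `T`.
  obtain ⟨ρ, hρ, hfρ⟩ := FTME.exists_closedBall_linearization hfd heq hκ0
  refine ⟨ρ, hρ, fun ε hε hεm => ?_⟩
  set K := (M * (M / d + C) + 1) * (4 * C) / m with hK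
  have hlarge : ∀ c a : ℝ, 0 < a → ∀ᶠ T : ℝ in atTop, c < a * T := fun c a ha =>
    (tendsto_id.const_mul_atTop ha).eventually_gt_atTop c
  have hcone : ∀ᶠ T : ℝ in atTop, 2 * Real.exp (-(ε / 4) * T) ≤ d / 2 := by
    have : Tendsto (fun T : ℝ => 2 * Real.exp (-(ε / 4) * T)) atTop (𝓝 (2 * 0)) :=
      (Real.tendsto_exp_atBot.comp
        (tendsto_id.const_mul_atTop_of_neg (by linarith : -(ε / 4) < 0))).const_mul 2
    exact this.eventually_le_const (by rw [mul_zero]; positivity)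
  obtain ⟨T₀, hT₀⟩ := eventually_atTop.1 <|
    (hlarge (Real.log (48 * Real.pi * C ^ 2)) ε hε).and <|
    (hlarge (Real.log (72 * Real.pi * M * C ^ 3 * d / l₁)) (3 / 4 * ε) (by positivity)).and <|
    (hlarge (-Real.log (Real.pi / (4 * d * C ^ 2 * (2 * K + 1)))) ε hε).and hcone
  refine ⟨max T₀ 1, by positivity, fun T hT X₀ hX₀ hX₀' => ?_⟩
  obtain ⟨hT₁, hT₂, hT₃, hTcone⟩ := hT₀ T ((le_max_left _ _).trans hT)
  have hT0 : 0 < T := one_pos.trans_le ((le_max_right _ _).trans hT)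
  set G := 2 * C * Real.exp (l₁ * T) + 3 * M * C with hG
  have hG0 : 0 < G := by positivity
  -- The tolerance depends on `T`: the error, amplified by `G`, must stay below both `e^{l₂T}` and
  -- half of the growth guaranteed in the unstable cone.
  set η := min (min (m / (4 * C)) (Real.exp (l₂ * T) / (4 * C))) (min (Real.exp (l₂ * T) / G)
    (Real.exp (l₁ * T) * l₁ * Real.exp (-(ε / 4) * T) / (2 * C * d) / G)) with hη
  have hη0 : 0 < η := by positivity
  have hη₁ : η ≤ m / (4 * C) := (min_le_left _ _).trans (min_le_left _ _)
  have hη₂ : η ≤ Real.exp (l₂ * T) / (4 * C) := (min_le_left _ _).trans (min_le_right _ _)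
  have hη₃ : η * G ≤ Real.exp (l₂ * T) :=
    (le_div_iff₀ hG0).1 ((min_le_right _ _).trans (min_le_left _ _))
  have hη₄ : η * G ≤ Real.exp (l₁ * T) * l₁ * Real.exp (-(ε / 4) * T) / (2 * C * d) :=
    (le_div_iff₀ hG0).1 ((min_le_right _ _).trans (min_le_right _ _))
  -- The slope at which the tangency estimate places the local stable manifold inside the stable
  -- cone.
  set θ := min 1 (ε / 4 * Real.exp ((l₂ - l₁) * T) / (d * C)) with hθ
  have hθ0 : 0 < θ := by positivity
  have hθd : d * (θ * C) ≤ ε / 4 * Real.exp ((l₂ - l₁) * T) := by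
    have := (le_div_iff₀ (by positivity)).1 (min_le_right 1
      (ε / 4 * Real.exp ((l₂ - l₁) * T) / (d * C)))
    linarith
  have hΦc : Continuous Φ := continuous_iff_continuousAt.2 fun t => (hΦ t).continuousAt
  obtain ⟨r, hr, hfr⟩ := FTME.exists_closedBall_linearization hfd heq hη0
  have hev : ∀ᶠ x in 𝓝 xs, X₀ ∈ 𝓝 x ∧
      (∃ D, HasFDerivAt (FTME.flow f U T) D x ∧ ‖D - Φ T‖ ≤ η) ∧
      ‖f x - fderiv ℝ f xs (x - xs)‖ ≤ η * ‖x - xs‖ ∧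
      (x ∈ FTME.localStable f U xs (Metric.closedBall xs ρ) →
        |p₁ (x - xs)| ≤ θ * |p₂ (x - xs)|) :=
    (eventually_mem_nhds_iff.2 hX₀').and <|
    (FTME.eventually_exists_hasFDerivAt_flow hfx heq hT0.le hΦ0 hΦ (Ψ := fun t => Φ (-t))
      (hΦc.comp continuous_neg) hΦΨ hX₀ hX₀' hη0).and <|
    (Metric.nhds_basis_closedBall.eventually_iff.2 ⟨r, hr, hfr⟩).and <|
    h.localStable_tangent hU hf1 hfd heq hκ0.le hκ₁ hκ₂ hfρ hθ0 (min_le_left _ _)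
  obtain ⟨δ, hδ, hδ'⟩ := Metric.nhds_basis_closedBall.eventually_iff.1 hev
  have key : ∀ x ∈ Metric.closedBall xs δ, x ≠ xs → f x ≠ 0 ∧ 0 ≤ FTME.weightedField f U T X₀ x ∧
      FTME.weightedField f U T X₀ x < ((l₁ - l₂ + ε : ℝ) : EReal) ∧
      (x ∈ FTME.unstableCone xs e₂ ε T → FTME.weightedField f U T X₀ x < (ε : EReal)) ∧
      (x ∈ FTME.stableCone xs e₂ l₁ l₂ ε T →
        ((l₁ - l₂ - ε : ℝ) : EReal) < FTME.weightedField f U T X₀ x) := by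
    intro x hx hne
    obtain ⟨hxX, ⟨D, hD, hDΦ⟩, hlin, -⟩ := hδ' hx
    exact h.weightedField_bounds (hΦ₁ T) (hΦ₂ T) hm0 (min_le_left _ _) (min_le_right _ _)
      (le_max_left _ _) (le_max_right _ _) hd hK (hεm.le.trans hmM) hη₁ hη₂ hη₃ hη₄ hT0 hX₀
      hxX hD hDΦ hlin hne hT₁ hT₂ hT₃
  have hstable : (FTME.localStable f U xs (Metric.closedBall xs ρ) ∩ Metric.closedBall xs δ) \ {xs} ⊆
      FTME.stableCone xs e₂ l₁ l₂ ε T := fun x hx =>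
    h.mem_stableCone hx.2 hθ0.le ((hδ' hx.1.2).2.2.2 hx.1.1) hθd
  refine ⟨δ, hδ, fun x hx => mem_of_mem_nhds (hδ' hx).1, fun x hx => (key x hx.1 hx.2).1,
    fun x hx => ⟨(key x hx.1 hx.2).2.1, (key x hx.1 hx.2).2.2.1⟩, fun x hx => ?_,
    fun x hx => ⟨(key x hx.2 hx.1.1).2.1, (key x hx.2 hx.1.1).2.2.2.1 hx.1⟩, hstable,
    fun x hx => lt_trans ?_ ((key x hx.2 hx.1.1).2.2.2.2 hx.1), fun x hx =>
      ⟨(key x hx.1.2 hx.2).2.2.2.2 (hstable hx), (key x hx.1.2 hx.2).2.2.1⟩⟩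
  · exact h.mem_unstableCone hx.2
      (h.localUnstable_cone hU hf1 hκ0.le hκ₁ hκ₂ hfρ hx.1.1) hTcone
  -- The stable cone yields the stronger bound `l₁ - l₂ - ε`, and `l₂ < 0`.
  · rw [EReal.coe_lt_coe_iff]
    linarith
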